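/- **Setting.** Fix layer sizes $p_0,\dots,p_D$, let $\mathcal W=\prod_{\ell=1}^D\mathbb R^{p_\ell\times p_{\ell-1}}$, identified with $\mathbb R^q$, $q=\sum_{\ell} p_\ell p_{\ell-1}$, and let $\{g_W:\mathbb R^{d_y}\to\mathbb R^{d_x},\ W\in\mathcal W\}$ be any family of measurable functions. Write $\|W\|_0,\|W\|_2,\|W\|_\infty$ for the number of non-zero entries, the Euclidean norm and the largest absolute entry of $W$. Let $\mathsf Y\subseteq\mathbb R^{d_y}$ be measurable (e.g. $\mathsf Y=\mathbb R^{d_y}$). *Data.* $(\mathbf x_i,\mathbf y_i)$, $1\le i\le n$, are independent pairs with $\mathbf y_i\in\mathsf Y$ a.s. and $\mathbf x_i=g(\mathbf y_i)+\boldsymbol\xi_i$, where $g:\mathbb R^{d_y}\to\mathbb R^{d_x}$ is measurable and, almost surely, the conditional law of $\boldsymbol\xi_i$ given $\mathbf y_i$ has mean $0$ and sub-Gaussian norm at most a non-random $\sigma_i$, i.e. $\mathbb E(e^{\langle v,\boldsymbol\xi_i\rangle}\mid\mathbf y_i)\le e^{\sigma_i^2\|v\|_2^2/2}$ for all $v\in\mathbb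 R^{d_x}$. Put $\bar\sigma=\max_i\sigma_i>0$ and $\|h\|_n=(\frac1n\sum_{i=1}^n\|h(\mathbf y_i)\|_2^2)^{1/2}$. *Local Lipschitz condition.* For every $\eta>0$ there is $L(\eta)\ge 1$ such that $\|g_W(\mathbf y)-g_{W'}(\mathbf y)\|_2\le L(\eta)\|W-W'\|_2$ for all $\mathbf y\in\mathsf Y$ and all $W,W'$ with $\max(\|W\|_2,\|W'\|_2)\le\eta$. *Prior and posterior.* Let $\mathsf u\ge1$, $\rho_0>0$, $\sigma>0$. The prior $\Pi_0$ on $(\Lambda,W)\in\{0,1\}^q\times\mathbb R^q$ has $\Pi_0(\Lambda)\propto q^{-(\mathsf u+1)\|\Lambda\|_0}$ and, given $\Lambda$, independent entries $W_j\sim N(0,1)$ if $\Lambda_j=1$ and $W_j\sim N(0,1/\rho_0)$ if $\Lambda_j=0$. The posterior is $$\Pi(d\Lambda,dW\mid\mathcal D)\propto \exp\Big(-\frac1{2\sigma^2}\sum_{i=1}^n\|\mathbf x_i-g_{\Lambda\odot W}(\mathbf y_i)\|_2^2\Big)\Pi_0(d\Lambda,dW),$$ with $\Lambda\odot W$ the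 component-wise product. **Theorem.** There are absolute constants $C,c_1>0$, and for all $\mathsf u\ge1$, $\sigma>0$ a number $q_0=q_0(\mathsf u,\sigma)$, such that the following holds in the above setting whenever $\sigma\ge\bar\sigma$, $q\ge\max(q_0,d_x)$ and $n\ge\sigma^2\log q$. Let $s_\star\ge1$ and $\varpi_\star\ge0$ be such that some $W$ with $\|W\|_0\le s_\star$ and $\|W\|_\infty\le1$ satisfies $\sup_{\mathbf y\in\mathsf Y}\|g_W(\mathbf y)-g(\mathbf y)\|_2\le\varpi_\star$. Put $\mathsf L_\star=L(2s_\star^{1/2})$, $$s=\Big(1+\frac{\log(\mathsf L_\star\sqrt n)}{\mathsf u\log q}\Big)s_\star+\frac{4n\varpi_\star^2}{\sigma^2\mathsf u\log q},\qquad \mathsf r=\bar\sigma\sqrt{\frac{s\log q+s\log\mathsf L_s}{n}},$$ where $\mathsf L_s=L(s^{1/2}b_s)$ and $b_s=\sqrt{2(1+\mathsf u)(1+s)\log q}$. Then there is $M\ge0$ with $$\mathsf u\max\big((\sigma/\bar\sigma)^2,1\big)\le M^2\le C\Big(\mathsf u\max\big((\sigma/\bar\sigma)^2,1\big)+\frac{\log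 n}{\log(q\,\mathsf L_s)}\Big)$$ such that, with probability at least $1-e^{-c_1n}-c_1/q$, $$\Pi\big(\|g_{\Lambda\odot W}-g\|_n>M\mathsf r\ \big|\ \mathcal D\big)\le\frac{12}{q}.$$ -/

import Mathlib

open MeasureTheory ProbabilityTheory
open scoped ENNReal NNReal

noncomputable section

namespace SparseBNN

/-- Index set of the entries of the weights `W = (W_D, …, W_1)` of a network with layer sizes
`p_0, …, p_D`, where `W_ℓ` is a `p_ℓ × p_{ℓ-1}` real matrix. -/
abbrev WeightIndex {D : ℕ} (p : Fin (D + 1) → ℕ) : Type :=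
  Σ l : Fin D, Fin (p l.succ) × Fin (p l.castSucc)

/-- Number of parameters `q = ∑_ℓ p_ℓ p_{ℓ-1}`. -/
def numParams {D : ℕ} (p : Fin (D + 1) → ℕ) : ℕ :=
  ∑ l : Fin D, p l.succ * p l.castSucc

theorem card_weightIndex {D : ℕ} (p : Fin (D + 1) → ℕ) :
    Fintype.card (WeightIndex p) = numParams p := by
  simp [numParams, WeightIndex]

section Weights

variable {ι : Type*} [Fintype ι] [DecidableEq ι]

/-- Number of non-zero entries of `W`. -/
def l0 (W : ι → ℝ) : ℕ := (Function.support W).ncard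

/-- Euclidean norm of the vectorized parameter `W`. -/
def l2 (W : ι → ℝ) : ℝ := Real.sqrt (∑ j, W j ^ 2)

/-- Number of active entries of a sparsity structure `Λ ∈ {0,1}^q`. -/
def activeCount (Λ : ι → Bool) : ℕ := (Finset.univ.filter fun j => Λ j = true).card

/-- The component-wise product `Λ ⊙ W`. -/
def mask (Λ : ι → Bool) (W : ι → ℝ) : ι → ℝ := fun j => if Λ j = true then W j else 0

/-- Unnormalized prior weight `(1/q)^((u+1) ‖Λ‖₀)` of a sparsity structure. -/
def structureWeight (u : ℝ) (Λ : ι → Bool) : ℝ :=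
  (1 / (Fintype.card ι : ℝ)) ^ ((u + 1) * (activeCount Λ : ℝ))

/-- Prior probability of a sparsity structure. -/
def structurePrior (u : ℝ) (Λ : ι → Bool) : ℝ :=
  structureWeight u Λ / ∑ Λ' : ι → Bool, structureWeight u Λ'

/-- Conditional prior of `W` given `Λ`: independent centered Gaussian entries, of variance `1`
on the active entries and of variance `1 / ρ₀` on the others. -/
def weightPrior (ρ₀ : ℝ) (Λ : ι → Bool) : Measure (ι → ℝ) :=
  Measure.pi fun j => gaussianReal 0 (if Λ j = true then 1 else (1 / ρ₀).toNNReal)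

/-- The spike-and-slab prior on `Θ = {0,1}^q × ℝ^q`. -/
def spikeSlabPrior (u ρ₀ : ℝ) : Measure ((ι → Bool) × (ι → ℝ)) :=
  ∑ Λ : ι → Bool,
    ENNReal.ofReal (structurePrior u Λ) • (weightPrior ρ₀ Λ).map (fun W => (Λ, W))

end Weights

section Posterior

variable {ι : Type*} [Fintype ι] [DecidableEq ι] {n dx dy : ℕ}

/-- Gaussian regression likelihood (up to a constant factor) of the weights `W`, for the data
`(x_i, y_i)`. -/
def likelihood (gW : (ι → ℝ) → EuclideanSpace ℝ (Fin dy) → EuclideanSpace ℝ (Fin dx)) (σ : ℝ)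
    (x : Fin n → EuclideanSpace ℝ (Fin dx)) (y : Fin n → EuclideanSpace ℝ (Fin dy))
    (W : ι → ℝ) : ℝ :=
  Real.exp (-(1 / (2 * σ ^ 2)) * ∑ i, ‖x i - gW W (y i)‖ ^ 2)

/-- The prior reweighted by the likelihood of `Λ ⊙ W`, before normalization. -/
def spikeSlabUnnormalized
    (gW : (ι → ℝ) → EuclideanSpace ℝ (Fin dy) → EuclideanSpace ℝ (Fin dx)) (u ρ₀ σ : ℝ)
    (x : Fin n → EuclideanSpace ℝ (Fin dx)) (y : Fin n → EuclideanSpace ℝ (Fin dy)) :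
    Measure ((ι → Bool) × (ι → ℝ)) :=
  (spikeSlabPrior u ρ₀).withDensity fun θ => ENNReal.ofReal (likelihood gW σ x y (mask θ.1 θ.2))

/-- The spike-and-slab posterior distribution given the data `(x_i, y_i)`. -/
def spikeSlabPosterior
    (gW : (ι → ℝ) → EuclideanSpace ℝ (Fin dy) → EuclideanSpace ℝ (Fin dx)) (u ρ₀ σ : ℝ)
    (x : Fin n → EuclideanSpace ℝ (Fin dx)) (y : Fin n → EuclideanSpace ℝ (Fin dy)) :
    Measure ((ι → Bool) × (ι → ℝ)) :=
  (spikeSlabUnnormalized gW u ρ₀ σ x y Set.univ)⁻¹ • spikeSlabUnnormalized gW u ρ₀ σ x y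

/-- The empirical norm `‖h‖_n` at the design points `y_1, …, y_n`. -/
def empNorm (y : Fin n → EuclideanSpace ℝ (Fin dy))
    (h : EuclideanSpace ℝ (Fin dy) → EuclideanSpace ℝ (Fin dx)) : ℝ :=
  Real.sqrt ((1 / (n : ℝ)) * ∑ i, ‖h (y i)‖ ^ 2)

end Posterior

/-- The law `ν` on `ℝ^d`, with mean `m`, has sub-Gaussian norm at most `c`:
`∫ exp ⟨v, z - m⟩ ν(dz) ≤ exp (c² ‖v‖² / 2)` for all `v`. -/
def SubGaussianNormLE {d : ℕ} (ν : Measure (EuclideanSpace ℝ (Fin d))) (c : ℝ) : Prop :=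
  Integrable (fun z => z) ν ∧ 0 ≤ c ∧
    ∀ v : EuclideanSpace ℝ (Fin d),
      ∫⁻ z, ENNReal.ofReal (Real.exp (inner ℝ v (z - ∫ z', z' ∂ν))) ∂ν
        ≤ ENNReal.ofReal (Real.exp (c ^ 2 * ‖v‖ ^ 2 / 2))

/-- The data-generating assumption: independent pairs `(x_i, y_i)`, with `y_i` in `Yset`, such
that `ξ_i = x_i - g(y_i)` has, conditionally on `y_i`, mean zero and sub-Gaussian norm at most
the non-random constant `σs i`. -/
structure IsSample {Ω : Type*} [MeasurableSpace Ω] (P : Measure Ω) [IsProbabilityMeasure P]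
    {n dx dy : ℕ} (Yset : Set (EuclideanSpace ℝ (Fin dy)))
    (g : EuclideanSpace ℝ (Fin dy) → EuclideanSpace ℝ (Fin dx))
    (X : Fin n → Ω → EuclideanSpace ℝ (Fin dx)) (Y : Fin n → Ω → EuclideanSpace ℝ (Fin dy))
    (σs : Fin n → ℝ) : Prop where
  measurable_X : ∀ i, Measurable (X i)
  measurable_Y : ∀ i, Measurable (Y i)
  indep : iIndepFun (fun i ω => (X i ω, Y i ω)) P
  mem_Yset : ∀ i, ∀ᵐ ω ∂P, Y i ω ∈ Yset
  condMean : ∀ i, ∀ᵐ y ∂(P.map (Y i)),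
    ∫ z, z ∂(condDistrib (fun ω => X i ω - g (Y i ω)) (Y i) P y) = 0
  condSubGaussian : ∀ i, ∀ᵐ y ∂(P.map (Y i)),
    SubGaussianNormLE (condDistrib (fun ω => X i ω - g (Y i ω)) (Y i) P y) (σs i)

/-- Local Lipschitz assumption on the function class `W ↦ g_W`, with constant `L(η) ≥ 1` on the
ball of radius `η`. -/
def LocallyLipschitzClass {ι : Type*} [Fintype ι] {dx dy : ℕ}
    (Yset : Set (EuclideanSpace ℝ (Fin dy)))
    (gW : (ι → ℝ) → EuclideanSpace ℝ (Fin dy) → EuclideanSpace ℝ (Fin dx)) (L : ℝ → ℝ) : Prop :=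
  ∀ η : ℝ, 0 < η → 1 ≤ L η ∧
    ∀ W W' : ι → ℝ, max (l2 W) (l2 W') ≤ η →
      ∀ y ∈ Yset, ‖gW W y - gW W' y‖ ≤ L η * l2 (W - W')

/-- `g` is approximated uniformly on `Yset` within `ϖ` by some `g_W` where `W` has at most `sstar`
non-zero entries, all bounded by `1` in absolute value. -/
def SparselyApproximable {ι : Type*} [Fintype ι] {dx dy : ℕ}
    (Yset : Set (EuclideanSpace ℝ (Fin dy)))
    (gW : (ι → ℝ) → EuclideanSpace ℝ (Fin dy) → EuclideanSpace ℝ (Fin dx))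
    (g : EuclideanSpace ℝ (Fin dy) → EuclideanSpace ℝ (Fin dx)) (sstar ϖ : ℝ) : Prop :=
  ∃ W : ι → ℝ, (l0 W : ℝ) ≤ sstar ∧ (∀ j, |W j| ≤ 1) ∧ ∀ y ∈ Yset, ‖gW W y - g y‖ ≤ ϖ

/-- The effective sparsity `s`, with `L⋆ = L(2 √s⋆)`. -/
def effSparsity (n q : ℕ) (u σ : ℝ) (L : ℝ → ℝ) (sstar ϖ : ℝ) : ℝ :=
  (1 + Real.log (L (2 * Real.sqrt sstar) * Real.sqrt n) / (u * Real.log q)) * sstar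
    + 4 * n * ϖ ^ 2 / (σ ^ 2 * u * Real.log q)

/-- `L_s = L(√s b_s)` with `b_s = √(2 (1 + u) (1 + s) log q)`. -/
def lipAt (q : ℕ) (u : ℝ) (L : ℝ → ℝ) (s : ℝ) : ℝ :=
  L (Real.sqrt s * Real.sqrt (2 * (1 + u) * (1 + s) * Real.log q))

/-- The contraction rate `r = σ̄ √((s log q + s log L_s) / n)`. -/
def rate (n q : ℕ) (u σbar : ℝ) (L : ℝ → ℝ) (s : ℝ) : ℝ :=
  σbar * Real.sqrt ((s * Real.log q + s * Real.log (lipAt q u L s)) / n)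

end SparseBNN

end

/-!
The posterior mass of `{‖g_{Λ⊙W} - g‖_n > ε}` is a ratio of two prior integrals of the likelihood
ratio `exp (⟨f, ξ⟩ / σ² - ‖f‖² / (2σ²))`, where `f = g_{Λ⊙W} - g` at the design points and `ξ` is
the noise. With high probability the numerator is smaller than the denominator by a factor of `q`.

*Denominator.* Only the sparsity structure of the approximating weights is kept, with weights in a
box of radius `σ √(log q) / (7 L⋆ √n)` around them. The prior mass of this box is at least
`q^{-(u+1)s⋆} (L⋆ √n)^{-s⋆}` up to a constant, and `s` is defined precisely so that, together with
the approximation error `ϖ`, this is at least about `q^{-(u+1)s}`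
(`IsSample.measure_evidence_lt_exp_le`). The noise is controlled pointwise by a Chernoff bound, and
on half of the box by Fubini and Markov.

*Numerator.* As `σ` is at least the noise level, the likelihood ratio has expectation at most one,
so by Markov's inequality a set of parameters that does not depend on the data contributes at most
`q` times its prior mass. This disposes of the structures with more than `6s` active entries, and of
the weights with `‖Λ⊙W‖₂ > √s b_s`, whose prior mass has a chi-squared tail. The Lipschitz
constant `L_s` is only available inside this ball, while the number of active entries may be
allowed to be a multiple of `s`. On the remaining sieve a union bound over a grid gives
`⟨f, ξ⟩ ≤ 3/8 ‖f‖²` uniformly over all `f` with `‖f‖_n > ε`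
(`IsSample.measure_exists_sieve_le`), so that the likelihood ratio is at most
`exp (-n ε² / (8σ²))`. The logarithm of the cardinality of the grid is of order
`s (log q + log L_s + log n)`; the last summand is the reason for the `log n` term in `M²`.

Throughout, the exponential moment of the noise is compensated by a random penalty evaluated at the
design points (`IsSample.lintegral_exp_mul_sum_le_one`), which makes conditioning on the design
unnecessary, and all exceptional events have probability `O(1/q)`.
-/

namespace SparseBNN

/-! ### Exponential moments of the noise -/

section Noise

variable {Ω : Type*} [MeasurableSpace Ω] {P : Measure Ω} [IsProbabilityMeasure P] {n dx dy : ℕ}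
  {Yset : Set (EuclideanSpace ℝ (Fin dy))}
  {g : EuclideanSpace ℝ (Fin dy) → EuclideanSpace ℝ (Fin dx)}
  {X : Fin n → Ω → EuclideanSpace ℝ (Fin dx)} {Y : Fin n → Ω → EuclideanSpace ℝ (Fin dy)}
  {σs : Fin n → ℝ} {c : ℝ}

/-- The conditional sub-Gaussian bound, integrated over the law of the design point. -/
theorem IsSample.lintegral_exp_inner_le_one (hS : IsSample P Yset g X Y σs) (hg : Measurable g)
    (i : Fin n) (hc : σs i ≤ c) {h : EuclideanSpace ℝ (Fin dy) → EuclideanSpace ℝ (Fin dx)}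
    (hh : Measurable h) :
    ∫⁻ ω, ENNReal.ofReal (Real.exp (inner ℝ (h (Y i ω)) (X i ω - g (Y i ω))
      - c ^ 2 * ‖h (Y i ω)‖ ^ 2 / 2)) ∂P ≤ 1 := by
  have hX := hS.measurable_X i
  have hY := hS.measurable_Y i
  have hξ : Measurable fun ω => X i ω - g (Y i ω) := hX.sub (hg.comp hY)
  let F : EuclideanSpace ℝ (Fin dy) × EuclideanSpace ℝ (Fin dx) → ℝ≥0∞ := fun p =>
    ENNReal.ofReal (Real.exp (inner ℝ (h p.1) p.2 - c ^ 2 * ‖h p.1‖ ^ 2 / 2))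
  have hF : Measurable F := by
    have h2 : Measurable fun p : EuclideanSpace ℝ (Fin dy) × EuclideanSpace ℝ (Fin dx) => h p.1 :=
      hh.comp measurable_fst
    fun_prop
  have key : ∫⁻ ω, F (Y i ω, X i ω - g (Y i ω)) ∂P =
      ∫⁻ y, ∫⁻ z, F (y, z) ∂(condDistrib (fun ω => X i ω - g (Y i ω)) (Y i) P y)
        ∂(P.map (Y i)) := by
    rw [← Measure.lintegral_compProd hF, compProd_map_condDistrib hξ.aemeasurable,
      lintegral_map hF (hY.prodMk hξ)]
  change ∫⁻ ω, F (Y i ω, X i ω - g (Y i ω)) ∂P ≤ 1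
  rw [key]
  have : IsProbabilityMeasure (P.map (Y i)) := Measure.isProbabilityMeasure_map hY.aemeasurable
  calc _ ≤ ∫⁻ _, 1 ∂(P.map (Y i)) := by
        apply lintegral_mono_ae
        filter_upwards [hS.condMean i, hS.condSubGaussian i] with y hm hsg
        obtain ⟨-, h0, hsg⟩ := hsg
        have h1 := hsg (h y)
        rw [hm] at h1
        simp only [sub_zero] at h1
        have : ∀ z, F (y, z) = ENNReal.ofReal (Real.exp (- (c ^ 2 * ‖h y‖ ^ 2 / 2))) *
            ENNReal.ofReal (Real.exp (inner ℝ (h y) z)) := by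
          intro z
          rw [← ENNReal.ofReal_mul (Real.exp_nonneg _), ← Real.exp_add]
          simp only [F]
          congr 2
          ring
        simp_rw [this]
        rw [lintegral_const_mul _ (by fun_prop)]
        refine (mul_le_mul_right h1 _).trans ?_
        rw [← ENNReal.ofReal_mul (Real.exp_nonneg _), ← Real.exp_add]
        apply ENNReal.ofReal_le_one.2
        apply Real.exp_le_one_iff.2
        have : σs i ^ 2 ≤ c ^ 2 := pow_le_pow_left₀ h0 hc 2
        nlinarith [mul_le_mul_of_nonneg_right this (sq_nonneg ‖h y‖)]
    _ = 1 := by simp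

theorem IsSample.lintegral_exp_sum_le_one (hS : IsSample P Yset g X Y σs) (hg : Measurable g)
    (hc : ∀ i, σs i ≤ c) {h : EuclideanSpace ℝ (Fin dy) → EuclideanSpace ℝ (Fin dx)}
    (hh : Measurable h) :
    ∫⁻ ω, ENNReal.ofReal (Real.exp (∑ i, (inner ℝ (h (Y i ω)) (X i ω - g (Y i ω))
      - c ^ 2 * ‖h (Y i ω)‖ ^ 2 / 2))) ∂P ≤ 1 := by
  let F : EuclideanSpace ℝ (Fin dx) × EuclideanSpace ℝ (Fin dy) → ℝ≥0∞ := fun p =>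
    ENNReal.ofReal (Real.exp (inner ℝ (h p.2) (p.1 - g p.2) - c ^ 2 * ‖h p.2‖ ^ 2 / 2))
  have hF : Measurable F := by
    have h2 : Measurable fun p : EuclideanSpace ℝ (Fin dx) × EuclideanSpace ℝ (Fin dy) => h p.2 :=
      hh.comp measurable_snd
    have h3 : Measurable fun p : EuclideanSpace ℝ (Fin dx) × EuclideanSpace ℝ (Fin dy) => g p.2 :=
      hg.comp measurable_snd
    fun_prop
  have hind : iIndepFun (fun i ω => F (X i ω, Y i ω)) P :=
    hS.indep.comp (fun _ => F) (fun _ => hF)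
  have hm : ∀ i, Measurable fun ω => F (X i ω, Y i ω) := fun i =>
    hF.comp ((hS.measurable_X i).prodMk (hS.measurable_Y i))
  have := lintegral_prod_eq_prod_lintegral_of_indepFun Finset.univ _ hind hm
  calc _ = ∫⁻ ω, ∏ i, F (X i ω, Y i ω) ∂P := by
        congr 1
        ext ω
        rw [Real.exp_sum, ENNReal.ofReal_prod_of_nonneg (fun i _ => Real.exp_nonneg _)]
    _ = ∏ i, ∫⁻ ω, F (X i ω, Y i ω) ∂P := this
    _ ≤ 1 := Finset.prod_le_one (fun _ _ => zero_le)
        (fun i _ => hS.lintegral_exp_inner_le_one hg i (hc i) hh)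

theorem IsSample.measurable_comp_Y (hS : IsSample P Yset g X Y σs) {E : Type*} [MeasurableSpace E]
    {h : EuclideanSpace ℝ (Fin dy) → E} (hh : Measurable h) (i : Fin n) :
    Measurable fun ω => h (Y i ω) :=
  hh.comp (hS.measurable_Y i)

/-- The noise tested against a fixed function, with a penalty that is random, as it is evaluated at
the design points: no conditioning on the design is needed. -/
theorem IsSample.lintegral_exp_mul_sum_le_one (hS : IsSample P Yset g X Y σs) (hg : Measurable g)
    (hc : ∀ i, σs i ≤ c) {h : EuclideanSpace ℝ (Fin dy) → EuclideanSpace ℝ (Fin dx)}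
    (hh : Measurable h) (a : ℝ) :
    ∫⁻ ω, ENNReal.ofReal (Real.exp (a * ∑ i, inner ℝ (h (Y i ω)) (X i ω - g (Y i ω))
      - a ^ 2 * c ^ 2 / 2 * ∑ i, ‖h (Y i ω)‖ ^ 2)) ∂P ≤ 1 := by
  have h1 := hS.lintegral_exp_sum_le_one hg hc (h := fun y => a • h y) (hh.const_smul a)
  have heq : ∀ ω, ∑ i, (inner ℝ (a • h (Y i ω)) (X i ω - g (Y i ω))
      - c ^ 2 * ‖a • h (Y i ω)‖ ^ 2 / 2) = a * ∑ i, inner ℝ (h (Y i ω)) (X i ω - g (Y i ω))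
      - a ^ 2 * c ^ 2 / 2 * ∑ i, ‖h (Y i ω)‖ ^ 2 := by
    intro ω
    rw [Finset.sum_sub_distrib, Finset.mul_sum, Finset.mul_sum]
    congr 1
    · exact Finset.sum_congr rfl fun i _ => by rw [real_inner_smul_left]
    · refine Finset.sum_congr rfl fun i _ => ?_
      rw [norm_smul, mul_pow, Real.norm_eq_abs, sq_abs]
      ring
  simpa only [heq] using h1

theorem IsSample.measure_lt_sum_inner_le (hS : IsSample P Yset g X Y σs) (hg : Measurable g)
    (hc : ∀ i, σs i ≤ c) {h : EuclideanSpace ℝ (Fin dy) → EuclideanSpace ℝ (Fin dx)}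
    (hh : Measurable h) (a t : ℝ) :
    P {ω | t < a * ∑ i, inner ℝ (h (Y i ω)) (X i ω - g (Y i ω))
      - a ^ 2 * c ^ 2 / 2 * ∑ i, ‖h (Y i ω)‖ ^ 2} ≤ ENNReal.ofReal (Real.exp (-t)) := by
  have h1 := hS.lintegral_exp_mul_sum_le_one hg hc hh a
  have hmeas : Measurable fun ω => ENNReal.ofReal (Real.exp (a * ∑ i, inner ℝ (h (Y i ω))
      (X i ω - g (Y i ω)) - a ^ 2 * c ^ 2 / 2 * ∑ i, ‖h (Y i ω)‖ ^ 2)) := by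
    have h2 := hS.measurable_comp_Y hh
    have h3 := hS.measurable_comp_Y hg
    have h4 := hS.measurable_X
    have h5 := hS.measurable_Y
    fun_prop
  have h5 := meas_ge_le_lintegral_div hmeas.aemeasurable
    (ε := ENNReal.ofReal (Real.exp t)) (μ := P) (by simp [Real.exp_pos]) (by simp)
  calc _ ≤ P {ω | ENNReal.ofReal (Real.exp t) ≤ ENNReal.ofReal (Real.exp (a * ∑ i, inner ℝ
        (h (Y i ω)) (X i ω - g (Y i ω)) - a ^ 2 * c ^ 2 / 2 * ∑ i, ‖h (Y i ω)‖ ^ 2))} := by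
        apply measure_mono
        intro ω hω
        exact ENNReal.ofReal_le_ofReal (Real.exp_le_exp.2 (le_of_lt hω))
    _ ≤ 1 / ENNReal.ofReal (Real.exp t) := h5.trans (ENNReal.div_le_div_right h1 _)
    _ = ENNReal.ofReal (Real.exp (-t)) := by
        rw [one_div, Real.exp_neg, ENNReal.ofReal_inv_of_pos (Real.exp_pos _)]

theorem sq_le_exp_add_exp_neg (x : ℝ) : x ^ 2 ≤ Real.exp x + Real.exp (-x) := by
  have key : ∀ z : ℝ, 0 ≤ z → z ^ 2 ≤ Real.exp z + Real.exp (-z) := by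
    intro z hz
    have h1 := Real.add_one_le_exp (-z)
    have h2 := Real.sum_le_exp_of_nonneg hz 4
    simp only [Finset.sum_range_succ, Finset.sum_range_zero, Nat.factorial] at h2
    norm_num at h2
    nlinarith [mul_nonneg hz (sq_nonneg (z - 3 / 2))]
  rcases le_total 0 x with h | h
  · exact key x h
  · have := key (-x) (by linarith)
    rw [neg_neg, neg_sq] at this
    linarith

theorem IsSample.lintegral_norm_sq_le (hS : IsSample P Yset g X Y σs) (hg : Measurable g)
    (i : Fin n) (hc : σs i ≤ c) (hc0 : 0 < c) :
    ∫⁻ ω, ENNReal.ofReal (‖X i ω - g (Y i ω)‖ ^ 2) ∂P ≤ ENNReal.ofReal (4 * dx * c ^ 2) := by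
  have hX := hS.measurable_X i
  have hY := hS.measurable_Y i
  have hξ : Measurable fun ω => X i ω - g (Y i ω) := hX.sub (hg.comp hY)
  let ξ : Ω → EuclideanSpace ℝ (Fin dx) := fun ω => X i ω - g (Y i ω)
  -- both one-sided exponential moments of a rescaled coordinate are at most `√e`
  have hcoord : ∀ (j : Fin dx) (b : ℝ), b ^ 2 = 1 →
      ∫⁻ ω, ENNReal.ofReal (Real.exp (b * (ξ ω j / c))) ∂P ≤ ENNReal.ofReal 2 := by
    intro j b hb
    have h1 := hS.lintegral_exp_inner_le_one hg i hc
      (h := fun _ => EuclideanSpace.single j (b / c)) measurable_const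
    have h2 : ∀ ω, ENNReal.ofReal (Real.exp (b * (ξ ω j / c))) = ENNReal.ofReal (Real.exp (1/2)) *
        ENNReal.ofReal (Real.exp (inner ℝ (EuclideanSpace.single j (b / c) :
          EuclideanSpace ℝ (Fin dx)) (X i ω - g (Y i ω))
          - c ^ 2 * ‖(EuclideanSpace.single j (b / c) : EuclideanSpace ℝ (Fin dx))‖ ^ 2 / 2)) := by
      intro ω
      rw [← ENNReal.ofReal_mul (Real.exp_nonneg _), ← Real.exp_add]
      congr 2
      simp only [EuclideanSpace.inner_single_left, PiLp.norm_single, Real.norm_eq_abs,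
        sq_abs, div_pow, hb]
      simp only [ξ]
      simp
      field_simp
      ring
    simp_rw [h2]
    rw [lintegral_const_mul' _ _ (by simp)]
    refine (mul_le_of_le_one_right zero_le h1).trans (ENNReal.ofReal_le_ofReal ?_)
    have h3 : Real.exp (1/2) * Real.exp (1/2) ≤ 2.7182818286 := by
      rw [← Real.exp_add, add_halves]; exact Real.exp_one_lt_d9.le
    nlinarith [Real.exp_pos (1/2)]
  have hpt : ∀ ω, ENNReal.ofReal (‖ξ ω‖ ^ 2) ≤ ∑ j, ENNReal.ofReal (c ^ 2) *
      (ENNReal.ofReal (Real.exp (1 * (ξ ω j / c))) +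
        ENNReal.ofReal (Real.exp (-1 * (ξ ω j / c)))) := by
    intro ω
    rw [EuclideanSpace.real_norm_sq_eq, ENNReal.ofReal_sum_of_nonneg (fun _ _ => sq_nonneg _)]
    apply Finset.sum_le_sum
    intro j _
    rw [← ENNReal.ofReal_add (Real.exp_nonneg _) (Real.exp_nonneg _),
      ← ENNReal.ofReal_mul (sq_nonneg _)]
    apply ENNReal.ofReal_le_ofReal
    have h1 : (ξ ω j / c) ^ 2 ≤ Real.exp (ξ ω j / c) + Real.exp (-(ξ ω j / c)) :=
      sq_le_exp_add_exp_neg _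
    have h2 : ξ ω j ^ 2 = c ^ 2 * (ξ ω j / c) ^ 2 := by field_simp
    rw [h2]
    apply mul_le_mul_of_nonneg_left _ (sq_nonneg _)
    simp only [one_mul, neg_one_mul]
    linarith
  have hξ' : Measurable ξ := hξ
  calc _ ≤ ∫⁻ ω, ∑ j, ENNReal.ofReal (c ^ 2) *
      (ENNReal.ofReal (Real.exp (1 * (ξ ω j / c))) +
        ENNReal.ofReal (Real.exp (-1 * (ξ ω j / c)))) ∂P := lintegral_mono hpt
    _ = ∑ j, ENNReal.ofReal (c ^ 2) * (∫⁻ ω, ENNReal.ofReal (Real.exp (1 * (ξ ω j / c))) ∂P +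
        ∫⁻ ω, ENNReal.ofReal (Real.exp (-1 * (ξ ω j / c))) ∂P) := by
        rw [lintegral_finsetSum _ (fun j _ => by fun_prop)]
        refine Finset.sum_congr rfl fun j _ => ?_
        rw [lintegral_const_mul _ (by fun_prop), lintegral_add_left (by fun_prop)]
    _ ≤ ∑ j : Fin dx, ENNReal.ofReal (c ^ 2) * (ENNReal.ofReal 2 + ENNReal.ofReal 2) := by
        gcongr with j
        · exact hcoord j 1 (by norm_num)
        · exact hcoord j (-1) (by norm_num)
    _ = ENNReal.ofReal (4 * dx * c ^ 2) := by
        rw [Finset.sum_const, Finset.card_univ, Fintype.card_fin, nsmul_eq_mul,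
          ← ENNReal.ofReal_add (by norm_num) (by norm_num), ← ENNReal.ofReal_mul (sq_nonneg _),
          ← ENNReal.ofReal_natCast, ← ENNReal.ofReal_mul (by positivity)]
        congr 1
        ring

/-- By Markov's inequality, the crude bound `∑ ‖ξ_i‖² ≤ n q² c²` is enough, as the net used for the
uniform bound on the noise can be chosen with a mesh that is polynomially small in `q`. -/
theorem IsSample.measure_sum_norm_sq_le (hS : IsSample P Yset g X Y σs) (hg : Measurable g)
    (hc : ∀ i, σs i ≤ c) (hc0 : 0 < c) {q : ℕ} (hq : 0 < q) (hdq : dx ≤ q) (hn : 0 < n) :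
    P {ω | n * q ^ 2 * c ^ 2 < ∑ i, ‖X i ω - g (Y i ω)‖ ^ 2} ≤ ENNReal.ofReal (4 / q) := by
  have hm : ∀ i, Measurable fun ω => ENNReal.ofReal (‖X i ω - g (Y i ω)‖ ^ 2) := fun i => by
    have h3 : Measurable fun ω => g (Y i ω) := hg.comp (hS.measurable_Y i)
    have h4 := hS.measurable_X i
    have h5 := hS.measurable_Y i
    fun_prop
  have hpos : (0 : ℝ) < n * q ^ 2 * c ^ 2 := by positivity
  have h1 : ∫⁻ ω, ∑ i, ENNReal.ofReal (‖X i ω - g (Y i ω)‖ ^ 2) ∂P ≤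
      ENNReal.ofReal (n * (4 * q * c ^ 2)) := by
    rw [lintegral_finsetSum _ (fun i _ => hm i)]
    calc _ ≤ ∑ i : Fin n, ENNReal.ofReal (4 * q * c ^ 2) := by
          refine Finset.sum_le_sum fun i _ => (hS.lintegral_norm_sq_le hg i (hc i) hc0).trans ?_
          apply ENNReal.ofReal_le_ofReal
          gcongr
      _ = _ := by
        rw [Finset.sum_const, Finset.card_univ, Fintype.card_fin, nsmul_eq_mul,
          ← ENNReal.ofReal_natCast, ← ENNReal.ofReal_mul (by positivity)]
  have h5 := meas_ge_le_lintegral_div (f := fun ω => ∑ i, ENNReal.ofReal (‖X i ω - g (Y i ω)‖ ^ 2))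
    (Finset.measurable_sum _ (fun i _ => hm i)).aemeasurable
    (ε := ENNReal.ofReal (n * q ^ 2 * c ^ 2)) (μ := P) (by simpa using hpos) (by simp)
  calc _ ≤ P {ω | ENNReal.ofReal (n * q ^ 2 * c ^ 2) ≤
        ∑ i, ENNReal.ofReal (‖X i ω - g (Y i ω)‖ ^ 2)} := by
        apply measure_mono
        intro ω hω
        simp only [Set.mem_ofPred_eq] at hω ⊢
        rw [← ENNReal.ofReal_sum_of_nonneg (fun _ _ => sq_nonneg _)]
        exact ENNReal.ofReal_le_ofReal hω.le
    _ ≤ ENNReal.ofReal (n * (4 * q * c ^ 2)) / ENNReal.ofReal (n * q ^ 2 * c ^ 2) :=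
        h5.trans (ENNReal.div_le_div_right h1 _)
    _ = ENNReal.ofReal (4 / q) := by
        rw [← ENNReal.ofReal_div_of_pos hpos]
        congr 1
        field_simp

end Noise

/-! ### The spike-and-slab prior -/

section Prior

variable {ι : Type*} [Fintype ι]

theorem sq_l2 (W : ι → ℝ) : l2 W ^ 2 = ∑ j, W j ^ 2 :=
  Real.sq_sqrt (Finset.sum_nonneg fun _ _ => sq_nonneg _)

theorem l2_nonneg (W : ι → ℝ) : 0 ≤ l2 W := Real.sqrt_nonneg _

theorem structureWeight_nonneg (u : ℝ) (Λ : ι → Bool) : 0 ≤ structureWeight u Λ := by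
  unfold structureWeight; positivity

theorem structureWeight_eq_exp [Nonempty ι] (u : ℝ) (Λ : ι → Bool) :
    structureWeight u Λ
      = Real.exp (-(u + 1) * Real.log (Fintype.card ι)) ^ activeCount Λ := by
  have hq : (0 : ℝ) < Fintype.card ι := by exact_mod_cast Fintype.card_pos
  rw [structureWeight, Real.rpow_def_of_pos (by positivity), ← Real.exp_nat_mul, one_div,
    Real.log_inv]
  congr 1
  ring

theorem div_ten_le_gaussianReal {w a : ℝ} (hw : |w| ≤ 1) (ha0 : 0 ≤ a) (ha1 : a ≤ 1) :
    ENNReal.ofReal (a / 10) ≤ gaussianReal 0 1 (Set.Icc (w - a) (w + a)) := by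
  rw [gaussianReal_apply 0 one_ne_zero]
  have hw' := abs_le.1 hw
  have hpdf : ∀ x ∈ Set.Icc (w - a) (w + a), ENNReal.ofReal (1 / 20) ≤ gaussianPDF 0 1 x := by
    intro x hx
    apply ENNReal.ofReal_le_ofReal
    rw [gaussianPDFReal]
    have h1 : Real.exp (-2) ≤ Real.exp (-(x - 0) ^ 2 / (2 * ((1 : ℝ≥0) : ℝ))) := by
      apply Real.exp_le_exp.2
      simp only [NNReal.coe_one]
      nlinarith [hx.1, hx.2]
    have h2 : √(2 * Real.pi * ((1 : ℝ≥0) : ℝ)) ≤ 2.6 := by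
      apply Real.sqrt_le_iff.2
      simp only [NNReal.coe_one]
      constructor <;> nlinarith [Real.pi_lt_d2]
    have h3 : (0.13 : ℝ) ≤ Real.exp (-2) := by
      rw [Real.exp_neg, show (2 : ℝ) = 1 + 1 by norm_num, Real.exp_add]
      rw [le_inv_comm₀ (by norm_num) (by positivity)]
      nlinarith [Real.exp_one_lt_d9, Real.exp_pos 1]
    have h4 : (2.6 : ℝ)⁻¹ ≤ (√(2 * Real.pi * ((1 : ℝ≥0) : ℝ)))⁻¹ :=
      inv_anti₀ (by simp [Real.pi_pos]) h2
    calc (1 / 20 : ℝ) = 2.6⁻¹ * 0.13 := by norm_num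
      _ ≤ _ := by gcongr; exact h3.trans h1
  calc ENNReal.ofReal (a / 10) = ∫⁻ _ in Set.Icc (w - a) (w + a), ENNReal.ofReal (1 / 20) := by
        rw [setLIntegral_const, Real.volume_Icc, ← ENNReal.ofReal_mul (by norm_num)]
        congr 1
        ring
    _ ≤ _ := setLIntegral_mono' measurableSet_Icc hpdf

/-- Prior mass of a box that only constrains the active entries. -/
theorem div_ten_pow_le_weightPrior (ρ₀ : ℝ) (Λ : ι → Bool) {w : ι → ℝ} (hw : ∀ j, |w j| ≤ 1)
    {a : ℝ} (ha0 : 0 ≤ a) (ha1 : a ≤ 1) :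
    ENNReal.ofReal ((a / 10) ^ activeCount Λ) ≤ weightPrior ρ₀ Λ
      (Set.univ.pi fun j => if Λ j = true then Set.Icc (w j - a) (w j + a) else Set.univ) := by
  rw [weightPrior, Measure.pi_pi, ENNReal.ofReal_pow (by positivity), activeCount,
    ← Finset.prod_const, Finset.prod_filter]
  refine Finset.prod_le_prod' fun j _ => ?_
  by_cases h : Λ j = true
  · simp only [h, if_true]
    exact div_ten_le_gaussianReal (hw j) ha0 ha1
  · simp [h]

theorem lintegral_prod_pi {Ω : ι → Type*} [∀ i, MeasurableSpace (Ω i)] (μ : ∀ i, Measure (Ω i))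
    [∀ i, IsProbabilityMeasure (μ i)] {F : ∀ i, Ω i → ℝ≥0∞} (hF : ∀ i, Measurable (F i)) :
    ∫⁻ x, ∏ i, F i (x i) ∂(Measure.pi μ) = ∏ i, ∫⁻ x, F i x ∂(μ i) := by
  have h := lintegral_prod_eq_prod_lintegral_of_indepFun Finset.univ
    (fun i (x : ∀ i, Ω i) => F i (x i)) (iIndepFun_pi (μ := μ) fun i => (hF i).aemeasurable)
    (fun i => (hF i).comp (measurable_pi_apply i))
  rw [h]
  refine Finset.prod_congr rfl fun i _ => ?_
  rw [← (measurePreserving_eval μ i).map_eq, lintegral_map (hF i) (measurable_pi_apply i)]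

theorem lintegral_exp_sq_gaussianReal :
    ∫⁻ x, ENNReal.ofReal (Real.exp (15 / 32 * x ^ 2)) ∂(gaussianReal 0 1) = ENNReal.ofReal 4 := by
  rw [gaussianReal_of_var_ne_zero 0 one_ne_zero,
    lintegral_withDensity_eq_lintegral_mul _ (measurable_gaussianPDF 0 1) (by fun_prop)]
  have h : ∀ x : ℝ, (gaussianPDF 0 1 * fun x => ENNReal.ofReal (Real.exp (15 / 32 * x ^ 2))) x =
      ENNReal.ofReal ((√(2 * Real.pi))⁻¹ * Real.exp (-(1 / 32) * x ^ 2)) := by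
    intro x
    rw [Pi.mul_apply, gaussianPDF, ← ENNReal.ofReal_mul (gaussianPDFReal_nonneg _ _ _),
      gaussianPDFReal, mul_assoc, ← Real.exp_add]
    simp only [NNReal.coe_one, mul_one, sub_zero]
    congr 3
    ring
  simp_rw [h]
  rw [← ofReal_integral_eq_lintegral_ofReal
    ((integrable_exp_neg_mul_sq (by norm_num)).const_mul _)
    (Filter.Eventually.of_forall fun x => by positivity), integral_const_mul, integral_gaussian]
  congr 1
  rw [← Real.sqrt_inv, ← Real.sqrt_mul (by positivity),
    show (2 * Real.pi)⁻¹ * (Real.pi / (1 / 32)) = 4 ^ 2 by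
      have := Real.pi_pos.ne'
      field_simp
      norm_num]
  exact Real.sqrt_sq (by norm_num)

theorem weightPrior_l2_mask_lt_le (ρ₀ : ℝ) (Λ : ι → Bool) {R : ℝ} (hR : 0 ≤ R) :
    weightPrior ρ₀ Λ {W | R < l2 (mask Λ W)} ≤
      ENNReal.ofReal (Real.exp (-(15 / 32 * R ^ 2)) * 4 ^ activeCount Λ) := by
  let F : ι → ℝ → ℝ≥0∞ := fun j x =>
    if Λ j = true then ENNReal.ofReal (Real.exp (15 / 32 * x ^ 2)) else 1
  have hF : ∀ j, Measurable (F j) := by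
    intro j
    by_cases h : Λ j = true
    · simp only [F, h, if_true]; fun_prop
    · simp only [F, h]; exact measurable_const
  have hprod : ∀ W : ι → ℝ, ∏ j, F j (W j) =
      ENNReal.ofReal (Real.exp (15 / 32 * l2 (mask Λ W) ^ 2)) := by
    intro W
    rw [sq_l2, Finset.mul_sum, Real.exp_sum,
      ENNReal.ofReal_prod_of_nonneg fun _ _ => Real.exp_nonneg _]
    refine Finset.prod_congr rfl fun j _ => ?_
    by_cases h : Λ j = true <;> simp [F, mask, h]
  have hint : ∫⁻ W, ∏ j, F j (W j) ∂(weightPrior ρ₀ Λ) = ENNReal.ofReal (4 ^ activeCount Λ) := by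
    rw [weightPrior, lintegral_prod_pi _ hF]
    have : ∀ j, ∫⁻ x, F j x ∂(gaussianReal 0 (if Λ j = true then 1 else (1 / ρ₀).toNNReal)) =
        if Λ j = true then ENNReal.ofReal 4 else 1 := by
      intro j
      by_cases h : Λ j = true
      · simp only [F, h, if_true, lintegral_exp_sq_gaussianReal]
      · simp [F, h]
    simp_rw [this]
    rw [Finset.prod_ite, Finset.prod_const, Finset.prod_const_one, mul_one, activeCount,
      ENNReal.ofReal_pow (by norm_num)]
  have hm : Measurable fun W : ι → ℝ => ∏ j, F j (W j) :=
    Finset.measurable_prod _ fun j _ => (hF j).comp (measurable_pi_apply j)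
  have h5 := meas_ge_le_lintegral_div hm.aemeasurable (μ := weightPrior ρ₀ Λ)
    (ε := ENNReal.ofReal (Real.exp (15 / 32 * R ^ 2))) (by simp [Real.exp_pos]) (by simp)
  calc _ ≤ weightPrior ρ₀ Λ {W | ENNReal.ofReal (Real.exp (15 / 32 * R ^ 2)) ≤ ∏ j, F j (W j)} := by
        apply measure_mono
        intro W hW
        simp only [Set.mem_ofPred_eq] at hW ⊢
        rw [hprod]
        apply ENNReal.ofReal_le_ofReal
        gcongr
    _ ≤ _ := h5
    _ = _ := by
        rw [hint, ← ENNReal.ofReal_div_of_pos (Real.exp_pos _), Real.exp_neg]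
        congr 1
        field_simp

variable [DecidableEq ι]

theorem sum_pow_activeCount (z : ℝ) :
    ∑ Λ : ι → Bool, z ^ activeCount Λ = (1 + z) ^ Fintype.card ι := by
  have h := Finset.prod_univ_sum (fun _ : ι => (Finset.univ : Finset Bool))
    (fun _ b => if b = true then z else 1)
  simp only [Fintype.univ_bool, Finset.mem_singleton, Bool.true_eq_false, not_false_eq_true,
    Finset.sum_insert, if_true, Finset.sum_singleton, Bool.false_eq_true, if_false,
    Finset.prod_const, Finset.card_univ] at h
  rw [add_comm, h, ← Fintype.univ_bool, Fintype.piFinset_univ]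
  refine Finset.sum_congr rfl fun Λ _ => ?_
  rw [Finset.prod_ite, Finset.prod_const, Finset.prod_const_one, mul_one, activeCount]

/-- Generating function of the number of active entries, with `1 + z ≤ e^z`. -/
theorem sum_structureWeight_mul_pow_le [Nonempty ι] (u : ℝ) {c : ℝ} (hc : 0 ≤ c) :
    ∑ Λ : ι → Bool, structureWeight u Λ * c ^ activeCount Λ
      ≤ Real.exp (c * Real.exp (-u * Real.log (Fintype.card ι))) := by
  have hq : (0 : ℝ) < Fintype.card ι := by exact_mod_cast Fintype.card_pos
  simp_rw [structureWeight_eq_exp, ← mul_pow]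
  rw [sum_pow_activeCount]
  calc _ ≤ Real.exp (Real.exp (-(u + 1) * Real.log (Fintype.card ι)) * c) ^ Fintype.card ι := by
        apply pow_le_pow_left₀ (by positivity)
        rw [add_comm]
        exact Real.add_one_le_exp _
    _ = _ := by
        rw [← Real.exp_nat_mul, show -(u + 1) * Real.log (Fintype.card ι)
          = -u * Real.log (Fintype.card ι) - Real.log (Fintype.card ι) by ring, Real.exp_sub,
          Real.exp_log hq]
        congr 1
        field_simp

theorem one_le_sum_structureWeight [Nonempty ι] (u : ℝ) :
    1 ≤ ∑ Λ : ι → Bool, structureWeight u Λ := by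
  simp_rw [structureWeight_eq_exp]
  rw [sum_pow_activeCount]
  exact one_le_pow₀ (by have := Real.exp_pos (-(u + 1) * Real.log (Fintype.card ι)); linarith)

theorem sum_structureWeight_le_three [Nonempty ι] {u : ℝ} (hu : 0 ≤ u) :
    ∑ Λ : ι → Bool, structureWeight u Λ ≤ 3 := by
  have h := sum_structureWeight_mul_pow_le (ι := ι) u zero_le_one
  simp only [one_pow, mul_one, one_mul] at h
  refine h.trans ((Real.exp_le_exp.2 (Real.exp_le_one_iff.2 ?_)).trans
    (Real.exp_one_lt_d9.le.trans (by norm_num)))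
  have : 0 ≤ Real.log (Fintype.card ι) := Real.log_natCast_nonneg _
  nlinarith

theorem structurePrior_nonneg (u : ℝ) (Λ : ι → Bool) : 0 ≤ structurePrior u Λ :=
  div_nonneg (structureWeight_nonneg u Λ)
    (Finset.sum_nonneg fun _ _ => structureWeight_nonneg u _)

theorem structurePrior_le_structureWeight [Nonempty ι] (u : ℝ) (Λ : ι → Bool) :
    structurePrior u Λ ≤ structureWeight u Λ :=
  div_le_self (structureWeight_nonneg u Λ) (one_le_sum_structureWeight u)

theorem structureWeight_div_three_le [Nonempty ι] {u : ℝ} (hu : 0 ≤ u) (Λ : ι → Bool) :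
    structureWeight u Λ / 3 ≤ structurePrior u Λ :=
  div_le_div_of_nonneg_left (structureWeight_nonneg u Λ)
    (zero_lt_one.trans_le (one_le_sum_structureWeight u)) (sum_structureWeight_le_three hu)

instance (ρ₀ : ℝ) (Λ : ι → Bool) : IsProbabilityMeasure (weightPrior ρ₀ Λ) := by
  unfold weightPrior; infer_instance

theorem lintegral_spikeSlabPrior (u ρ₀ : ℝ) (F : (ι → Bool) × (ι → ℝ) → ℝ≥0∞) :
    ∫⁻ θ, F θ ∂(spikeSlabPrior u ρ₀) =
      ∑ Λ, ENNReal.ofReal (structurePrior u Λ) * ∫⁻ W, F (Λ, W) ∂(weightPrior ρ₀ Λ) := by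
  rw [spikeSlabPrior, lintegral_finsetSum_measure]
  refine Finset.sum_congr rfl fun Λ _ => ?_
  rw [lintegral_smul_measure, (measurableEmbedding_prodMk_left Λ).lintegral_map, smul_eq_mul]

theorem spikeSlabPrior_apply (u ρ₀ : ℝ) (A : Set ((ι → Bool) × (ι → ℝ))) :
    spikeSlabPrior u ρ₀ A =
      ∑ Λ, ENNReal.ofReal (structurePrior u Λ) * weightPrior ρ₀ Λ {W | (Λ, W) ∈ A} := by
  rw [spikeSlabPrior, Measure.finsetSum_apply]
  refine Finset.sum_congr rfl fun Λ _ => ?_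
  rw [Measure.smul_apply, (measurableEmbedding_prodMk_left Λ).map_apply, smul_eq_mul]
  rfl

instance [Nonempty ι] (u ρ₀ : ℝ) :
    IsProbabilityMeasure (spikeSlabPrior u ρ₀ : Measure ((ι → Bool) × (ι → ℝ))) := by
  constructor
  rw [spikeSlabPrior_apply]
  simp only [Set.mem_univ, Set.ofPred_true, measure_univ, mul_one]
  rw [← ENNReal.ofReal_sum_of_nonneg fun _ _ => structurePrior_nonneg u _]
  simp only [structurePrior]
  rw [← Finset.sum_div, div_self (zero_lt_one.trans_le (one_le_sum_structureWeight u)).ne']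
  simp

/-- Exponential Markov inequality for the binomial number of active entries. -/
theorem spikeSlabPrior_activeCount_lt_le [Nonempty ι] {u : ℝ} (hu : 0 ≤ u) (ρ₀ κ : ℝ) :
    spikeSlabPrior u ρ₀ {θ : (ι → Bool) × (ι → ℝ) | κ < activeCount θ.1}
      ≤ ENNReal.ofReal (Real.exp (1 - u * κ * Real.log (Fintype.card ι))) := by
  set l := Real.log (Fintype.card ι) with hl
  have hl0 : 0 ≤ l := Real.log_natCast_nonneg _
  rw [spikeSlabPrior_apply]
  have hterm : ∀ Λ : ι → Bool, ENNReal.ofReal (structurePrior u Λ) *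
      weightPrior ρ₀ Λ {W | (Λ, W) ∈ {θ : (ι → Bool) × (ι → ℝ) | κ < activeCount θ.1}} ≤
      ENNReal.ofReal (Real.exp (-(u * κ * l)) *
        (structureWeight u Λ * Real.exp (u * l) ^ activeCount Λ)) := by
    intro Λ
    by_cases h : κ < activeCount Λ
    · calc _ ≤ ENNReal.ofReal (structurePrior u Λ) * 1 := by gcongr; exact prob_le_one
        _ ≤ _ := by
          rw [mul_one]
          apply ENNReal.ofReal_le_ofReal
          refine (structurePrior_le_structureWeight u Λ).trans ?_
          rw [mul_left_comm]
          apply le_mul_of_one_le_right (structureWeight_nonneg u Λ)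
          rw [← Real.exp_nat_mul, ← Real.exp_add]
          apply Real.one_le_exp
          have := mul_le_mul_of_nonneg_left h.le (mul_nonneg hu hl0)
          linarith
    · simp [h]
  refine (Finset.sum_le_sum fun Λ _ => hterm Λ).trans ?_
  rw [← ENNReal.ofReal_sum_of_nonneg fun Λ _ => mul_nonneg (Real.exp_nonneg _)
    (mul_nonneg (structureWeight_nonneg u Λ) (by positivity)), ← Finset.mul_sum]
  apply ENNReal.ofReal_le_ofReal
  refine (mul_le_mul_of_nonneg_left (sum_structureWeight_mul_pow_le u (Real.exp_nonneg _))
    (Real.exp_nonneg _)).trans ?_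
  rw [← hl, ← Real.exp_add, ← Real.exp_add]
  apply Real.exp_le_exp.2
  rw [show u * l + -u * l = 0 by ring, Real.exp_zero]
  linarith

/-- A chi-squared tail bound; the factor `q^{-u}` is the price of having an active entry. -/
theorem spikeSlabPrior_l2_mask_lt_le [Nonempty ι] {u : ℝ} (hu : 0 ≤ u) (ρ₀ : ℝ) {R : ℝ}
    (hR : 0 ≤ R) :
    spikeSlabPrior u ρ₀ {θ : (ι → Bool) × (ι → ℝ) | R < l2 (mask θ.1 θ.2)}
      ≤ ENNReal.ofReal
        (Real.exp (4 - u * Real.log (Fintype.card ι) - 15 / 32 * R ^ 2)) := by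
  set l := Real.log (Fintype.card ι) with hl
  have hl0 : 0 ≤ l := Real.log_natCast_nonneg _
  rw [spikeSlabPrior_apply]
  have hterm : ∀ Λ : ι → Bool, ENNReal.ofReal (structurePrior u Λ) *
      weightPrior ρ₀ Λ {W | (Λ, W) ∈ {θ : (ι → Bool) × (ι → ℝ) | R < l2 (mask θ.1 θ.2)}} ≤
      ENNReal.ofReal (Real.exp (-(u * l) - 15 / 32 * R ^ 2) *
        (structureWeight u Λ * (4 * Real.exp (u * l)) ^ activeCount Λ)) := by
    intro Λ
    by_cases h : activeCount Λ = 0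
    · have hz : ∀ W : ι → ℝ, l2 (mask Λ W) = 0 := by
        intro W
        have : ∀ j, mask Λ W j = 0 := by
          intro j
          rw [activeCount, Finset.card_eq_zero, Finset.filter_eq_empty_iff] at h
          simp [mask, h (Finset.mem_univ j)]
        simp [l2, this]
      simp [hz, not_lt.2 hR]
    · calc _ ≤ ENNReal.ofReal (structurePrior u Λ) *
            ENNReal.ofReal (Real.exp (-(15 / 32 * R ^ 2)) * 4 ^ activeCount Λ) := by
            gcongr
            exact weightPrior_l2_mask_lt_le ρ₀ Λ hR
        _ ≤ _ := by
          rw [← ENNReal.ofReal_mul (structurePrior_nonneg u Λ)]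
          apply ENNReal.ofReal_le_ofReal
          refine (mul_le_mul_of_nonneg_right (structurePrior_le_structureWeight u Λ)
            (by positivity)).trans ?_
          have h1 : 1 ≤ Real.exp (-(u * l)) * Real.exp (u * l) ^ activeCount Λ := by
            rw [← Real.exp_nat_mul, ← Real.exp_add]
            apply Real.one_le_exp
            have h1 : (1 : ℝ) ≤ activeCount Λ := by exact_mod_cast Nat.one_le_iff_ne_zero.2 h
            nlinarith [mul_nonneg hu hl0]
          rw [sub_eq_add_neg, Real.exp_add, mul_pow]
          have h2 := structureWeight_nonneg u Λ
          calc _ = structureWeight u Λ * (Real.exp (-(15 / 32 * R ^ 2)) * 4 ^ activeCount Λ) * 1 :=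
                (mul_one _).symm
            _ ≤ structureWeight u Λ * (Real.exp (-(15 / 32 * R ^ 2)) * 4 ^ activeCount Λ) *
                (Real.exp (-(u * l)) * Real.exp (u * l) ^ activeCount Λ) := by gcongr
            _ = _ := by ring
  refine (Finset.sum_le_sum fun Λ _ => hterm Λ).trans ?_
  rw [← ENNReal.ofReal_sum_of_nonneg fun Λ _ => mul_nonneg (Real.exp_nonneg _)
    (mul_nonneg (structureWeight_nonneg u Λ) (by positivity)), ← Finset.mul_sum]
  apply ENNReal.ofReal_le_ofReal
  refine (mul_le_mul_of_nonneg_left (sum_structureWeight_mul_pow_le u (by positivity))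
    (Real.exp_nonneg _)).trans ?_
  rw [← hl, ← Real.exp_add]
  apply Real.exp_le_exp.2
  rw [mul_assoc, ← Real.exp_add, show u * l + -u * l = 0 by ring, Real.exp_zero]
  linarith

end Prior

/-! ### A grid for sparse vectors -/

theorem exists_finset_grid_real {a R : ℝ} (ha : 0 < a) (hR : 0 ≤ R) :
    ∃ G : Finset ℝ, (G.card : ℝ) ≤ 2 * (R / a) + 1 ∧
      ∀ x : ℝ, |x| ≤ R → ∃ x' ∈ G, |x'| ≤ |x| ∧ |x - x'| ≤ a := by
  have hB : 0 ≤ ⌊R / a⌋ := Int.floor_nonneg.2 (by positivity)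
  refine ⟨(Finset.Icc (-⌊R / a⌋) ⌊R / a⌋).image fun z : ℤ => a * z, ?_, fun x hx => ?_⟩
  · have h1 : ((Finset.Icc (-⌊R / a⌋) ⌊R / a⌋).card : ℤ) = 2 * ⌊R / a⌋ + 1 := by
      rw [Int.card_Icc, Int.toNat_of_nonneg (by omega)]
      ring
    have h2 : ((Finset.Icc (-⌊R / a⌋) ⌊R / a⌋).card : ℝ) = 2 * ⌊R / a⌋ + 1 := by exact_mod_cast h1
    refine (Nat.cast_le.2 Finset.card_image_le).trans ?_
    rw [h2]
    have := Int.floor_le (R / a)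
    linarith
  · have key : ∀ z : ℝ, 0 ≤ z → z ≤ R → ⌊z / a⌋ ∈ Finset.Icc (-⌊R / a⌋) ⌊R / a⌋ ∧
        0 ≤ a * (⌊z / a⌋ : ℝ) ∧ a * (⌊z / a⌋ : ℝ) ≤ z ∧ z - a * (⌊z / a⌋ : ℝ) ≤ a := by
      intro z hz hzR
      have h0 : 0 ≤ ⌊z / a⌋ := Int.floor_nonneg.2 (by positivity)
      have h1 : ⌊z / a⌋ ≤ ⌊R / a⌋ := Int.floor_le_floor (by gcongr)
      have h2 : a * (⌊z / a⌋ : ℝ) ≤ a * (z / a) := by gcongr; exact Int.floor_le _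
      have h3 : a * (z / a) ≤ a * (⌊z / a⌋ + 1 : ℝ) := by gcongr; exact (Int.lt_floor_add_one _).le
      rw [mul_div_cancel₀ _ ha.ne'] at h2 h3
      refine ⟨Finset.mem_Icc.2 ⟨by omega, h1⟩, ?_, h2, by linarith⟩
      have : (0 : ℝ) ≤ ⌊z / a⌋ := by exact_mod_cast h0
      positivity
    rcases le_total 0 x with h | h
    · rw [abs_of_nonneg h] at hx ⊢
      obtain ⟨h1, h2, h3, h4⟩ := key x h hx
      refine ⟨a * ⌊x / a⌋, Finset.mem_image_of_mem _ h1, ?_, ?_⟩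
      · rwa [abs_of_nonneg h2]
      · rwa [abs_of_nonneg (by linarith)]
    · rw [abs_of_nonpos h] at hx ⊢
      obtain ⟨h1, h2, h3, h4⟩ := key (-x) (by linarith) hx
      refine ⟨a * ((-⌊-x / a⌋ : ℤ) : ℝ), Finset.mem_image_of_mem _ ?_, ?_, ?_⟩
      · rw [Finset.mem_Icc] at h1 ⊢
        omega
      · push_cast
        rw [mul_neg, abs_neg, abs_of_nonneg h2]
        exact h3
      · push_cast
        rw [abs_le]
        constructor <;> linarith

/-- Sparse vectors are approximated by grid points which they dominate entrywise, so that the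
grid points lie in every Euclidean ball around `0` that contains the vector. -/
theorem exists_finset_grid_sparse {ι : Type*} [Fintype ι] [DecidableEq ι] [Nonempty ι] {a R : ℝ}
    (ha : 0 < a) (hR : 0 ≤ R) (m : ℕ) :
    ∃ T : Finset (ι → ℝ), (T.card : ℝ) ≤ (Fintype.card ι * (2 * (R / a) + 1)) ^ m ∧
      ∀ V : ι → ℝ, l0 V ≤ m → (∀ j, |V j| ≤ R) →
        ∃ V' ∈ T, (∀ j, |V' j| ≤ |V j|) ∧ ∀ j, |V j - V' j| ≤ a := by
  obtain ⟨G, hGcard, hG⟩ := exists_finset_grid_real ha hR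
  induction m with
  | zero =>
    refine ⟨{0}, by simp, fun V hV _ => ⟨0, by simp, fun j => by simp, fun j => ?_⟩⟩
    rw [l0, Nat.le_zero, Set.ncard_eq_zero (Set.toFinite _), Function.support_eq_empty_iff] at hV
    simp [hV, ha.le]
  | succ m ih =>
    obtain ⟨T, hTcard, hT⟩ := ih
    refine ⟨(T ×ˢ (Finset.univ : Finset ι) ×ˢ G).image
      fun p => Function.update p.1 p.2.1 p.2.2, ?_, fun V hV hVR => ?_⟩
    · refine (Nat.cast_le.2 Finset.card_image_le).trans ?_
      rw [Finset.card_product, Finset.card_product, Finset.card_univ]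
      push_cast
      rw [pow_succ]
      gcongr
    · obtain ⟨j, hj⟩ : ∃ j, l0 (Function.update V j 0) ≤ m := by
        by_cases h : ∃ j, V j ≠ 0
        · obtain ⟨j, hj⟩ := h
          refine ⟨j, ?_⟩
          have hs : Function.support (Function.update V j 0) = Function.support V \ {j} := by
            ext k
            by_cases hk : k = j <;> simp [hk]
          have := Set.ncard_sdiff_singleton_of_mem (s := Function.support V) (a := j) hj
          rw [l0] at hV ⊢
          rw [hs, this]
          omega
        · push Not at h
          refine ⟨Classical.arbitrary ι, ?_⟩
          have : Function.support (Function.update V (Classical.arbitrary ι) 0) = ∅ := by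
            rw [Function.support_eq_empty_iff]
            ext k
            by_cases hk : k = Classical.arbitrary ι <;> simp [hk, h]
          simp [l0, this]
      have hle : ∀ k, |Function.update V j 0 k| ≤ |V k| := by
        intro k
        by_cases hk : k = j
        · subst hk; simp
        · simp [hk]
      obtain ⟨V', hV', h1, h2⟩ := hT _ hj fun k => (hle k).trans (hVR k)
      obtain ⟨x', hx', h3, h4⟩ := hG (V j) (hVR j)
      refine ⟨Function.update V' j x', Finset.mem_image.2 ⟨(V', j, x'), by simp [hV', hx'], rfl⟩,
        fun k => ?_, fun k => ?_⟩
      · by_cases hk : k = j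
        · subst hk; simpa using h3
        · simpa [hk] using h1 k
      · by_cases hk : k = j
        · subst hk; simpa using h4
        · simpa [hk] using h2 k

/-! ### Uniform control of the noise on the sieve -/

theorem l2_le_l2 {ι : Type*} [Fintype ι] {V W : ι → ℝ} (h : ∀ j, |V j| ≤ |W j|) : l2 V ≤ l2 W :=
  Real.sqrt_le_sqrt (Finset.sum_le_sum fun j _ => sq_le_sq.2 (h j))

theorem abs_apply_le_l2 {ι : Type*} [Fintype ι] (V : ι → ℝ) (j : ι) : |V j| ≤ l2 V :=
  Real.abs_le_sqrt (Finset.single_le_sum (f := fun j => V j ^ 2) (fun _ _ => sq_nonneg _)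
    (Finset.mem_univ j))

section Deterministic

variable {n : ℕ} {E : Type*} [NormedAddCommGroup E] [InnerProductSpace ℝ E]

theorem sum_inner_le_of_large {ξ f : Fin n → E} {B ε : ℝ} (hξ : ∑ i, ‖ξ i‖ ^ 2 ≤ n * B ^ 2)
    (hB : 0 ≤ B) (hε : 4 * B ≤ ε) (hf : n * ε ^ 2 ≤ ∑ i, ‖f i‖ ^ 2) :
    ∑ i, inner ℝ (f i) (ξ i) ≤ 3 / 8 * ∑ i, ‖f i‖ ^ 2 := by
  have h1 : ∑ i, inner ℝ (f i) (ξ i) ≤ ∑ i, (1 / 8 * ‖f i‖ ^ 2 + 2 * ‖ξ i‖ ^ 2) := by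
    refine Finset.sum_le_sum fun i _ => (real_inner_le_norm _ _).trans ?_
    nlinarith [sq_nonneg (‖f i‖ - 4 * ‖ξ i‖)]
  rw [Finset.sum_add_distrib, ← Finset.mul_sum, ← Finset.mul_sum] at h1
  have h2 : (4 * B) ^ 2 ≤ ε ^ 2 := pow_le_pow_left₀ (by positivity) hε 2
  have h3 : (n : ℝ) * (4 * B) ^ 2 ≤ n * ε ^ 2 := by gcongr
  have h4 : 0 ≤ ∑ i, ‖f i‖ ^ 2 := Finset.sum_nonneg fun _ _ => sq_nonneg _
  nlinarith

/-- The noise at `f` is controlled by the noise at a nearby `f'`, since the noise has empirical norm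
at most `B` and `f'` is within `ε² / (16 B)` of `f`. -/
theorem sum_inner_le_of_near {ξ f f' : Fin n → E} {B ε : ℝ} (hξ : ∑ i, ‖ξ i‖ ^ 2 ≤ n * B ^ 2)
    (hB : 0 < B) (hε0 : 0 < ε) (hε : ε ≤ 4 * B) (hf : n * ε ^ 2 ≤ ∑ i, ‖f i‖ ^ 2)
    (hff' : ∀ i, ‖f i - f' i‖ ≤ ε ^ 2 / (16 * B))
    (hf' : ∑ i, inner ℝ (f' i) (ξ i) ≤ 1 / 16 * ∑ i, ‖f' i‖ ^ 2 + n * ε ^ 2 / 64) :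
    ∑ i, inner ℝ (f i) (ξ i) ≤ 3 / 8 * ∑ i, ‖f i‖ ^ 2 := by
  set δ := ε ^ 2 / (16 * B) with hδ
  have hδ0 : 0 ≤ δ := by positivity
  have hδB : δ * B = ε ^ 2 / 16 := by rw [hδ]; field_simp
  have hδε : δ ≤ ε / 4 := by
    rw [hδ, div_le_div_iff₀ (by positivity) (by positivity)]
    nlinarith
  have h1 : ∑ i, inner ℝ (f i) (ξ i) ≤
      ∑ i, inner ℝ (f' i) (ξ i) + ∑ i, (δ * B / 2 + δ / (2 * B) * ‖ξ i‖ ^ 2) := by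
    rw [← Finset.sum_add_distrib]
    refine Finset.sum_le_sum fun i _ => ?_
    have h2 : inner ℝ (f i) (ξ i) = inner ℝ (f' i) (ξ i) + inner ℝ (f i - f' i) (ξ i) := by
      rw [← inner_add_left]; congr 1; abel
    rw [h2]
    have h3 : inner ℝ (f i - f' i) (ξ i) ≤ δ * ‖ξ i‖ :=
      (real_inner_le_norm _ _).trans (by gcongr; exact hff' i)
    have h4 : δ * ‖ξ i‖ ≤ δ * B / 2 + δ / (2 * B) * ‖ξ i‖ ^ 2 := by
      have : δ * B / 2 + δ / (2 * B) * ‖ξ i‖ ^ 2 - δ * ‖ξ i‖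
          = δ / (2 * B) * (‖ξ i‖ - B) ^ 2 := by field_simp; ring
      have h5 : 0 ≤ δ / (2 * B) * (‖ξ i‖ - B) ^ 2 := by positivity
      linarith
    linarith
  rw [Finset.sum_add_distrib, Finset.sum_const, Finset.card_univ, Fintype.card_fin, nsmul_eq_mul,
    ← Finset.mul_sum] at h1
  have h2 : δ / (2 * B) * ∑ i, ‖ξ i‖ ^ 2 ≤ n * (δ * B / 2) := by
    calc _ ≤ δ / (2 * B) * (n * B ^ 2) := by gcongr
      _ = _ := by field_simp
  have h3 : ∑ i, ‖f' i‖ ^ 2 ≤ ∑ i, (2 * ‖f i‖ ^ 2 + 2 * (ε / 4) ^ 2) := by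
    refine Finset.sum_le_sum fun i _ => ?_
    have h4 : ‖f' i‖ ≤ ‖f i‖ + ε / 4 := by
      have h5 : ‖f' i‖ ≤ ‖f i‖ + ‖f i - f' i‖ := by
        have := norm_sub_le (f i) (f i - f' i)
        rwa [sub_sub_cancel] at this
      linarith [hff' i]
    have h6 := norm_nonneg (f' i)
    nlinarith [sq_nonneg (‖f i‖ - ε / 4)]
  rw [Finset.sum_add_distrib, Finset.sum_const, Finset.card_univ, Fintype.card_fin, nsmul_eq_mul,
    ← Finset.mul_sum] at h3
  rw [hδB] at h1 h2
  nlinarith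

end Deterministic

section Noise

variable {Ω : Type*} [MeasurableSpace Ω] {P : Measure Ω} [IsProbabilityMeasure P] {n dx dy : ℕ}
  {Yset : Set (EuclideanSpace ℝ (Fin dy))}
  {g : EuclideanSpace ℝ (Fin dy) → EuclideanSpace ℝ (Fin dx)}
  {X : Fin n → Ω → EuclideanSpace ℝ (Fin dx)} {Y : Fin n → Ω → EuclideanSpace ℝ (Fin dy)}
  {σs : Fin n → ℝ} {c : ℝ} {ι : Type*} [Fintype ι] [DecidableEq ι] [Nonempty ι]

/-- Uniformly over the sieve of sparse vectors `V` of norm at most `R`, the noise is dominated by the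
squared empirical norm of `f V` as soon as the latter is at least `n ε²`. If `ε` exceeds four times
the crude bound `q c` on the noise, this is immediate; otherwise the functions on the sieve are
approximated within `ε² / (16 q c) ≤ ε / 4` by those of a grid. -/
theorem IsSample.measure_exists_sieve_le (hS : IsSample P Yset g X Y σs) (hg : Measurable g)
    (hc : ∀ i, σs i ≤ c) (hc0 : 0 < c) (hd : dx ≤ Fintype.card ι) (hn : 0 < n)
    {f : (ι → ℝ) → EuclideanSpace ℝ (Fin dy) → EuclideanSpace ℝ (Fin dx)}
    (hf : ∀ V, Measurable (f V)) {R Ls ε κ : ℝ} (hR : 0 ≤ R) (hLs : 0 < Ls) (hε : 0 < ε)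
    (hlip : ∀ V V', l2 V ≤ R → l2 V' ≤ R → ∀ y, ‖f V y - f V' y‖ ≤ Ls * l2 (V - V')) :
    P {ω | ∃ V, (l0 V : ℝ) ≤ κ ∧ l2 V ≤ R ∧ n * ε ^ 2 ≤ ∑ i, ‖f V (Y i ω)‖ ^ 2 ∧
        3 / 8 * ∑ i, ‖f V (Y i ω)‖ ^ 2 <
          ∑ i, inner ℝ (f V (Y i ω)) (X i ω - g (Y i ω))} ≤
      ENNReal.ofReal (4 / Fintype.card ι) + ENNReal.ofReal ((Fintype.card ι * (2 * (R /
        (ε ^ 2 / (16 * (Fintype.card ι * c)) / (Ls * √(Fintype.card ι)))) + 1)) ^ ⌊κ⌋₊ *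
        Real.exp (-(n * ε ^ 2 / (512 * c ^ 2)))) := by
  set q := Fintype.card ι with hq
  have hq0 : 0 < q := Fintype.card_pos
  have hqR : (0 : ℝ) < q := by exact_mod_cast hq0
  set B := q * c with hB
  have hB0 : 0 < B := by positivity
  set a := ε ^ 2 / (16 * B) / (Ls * √q) with ha
  have ha0 : 0 < a := by have := Real.sqrt_pos.2 hqR; positivity
  obtain ⟨T, hTcard, hT⟩ := exists_finset_grid_sparse (ι := ι) ha0 hR ⌊κ⌋₊
  -- exceptional event at a grid point, with the tilt `1 / (8 c²)` of the Chernoff bound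
  let Bad : (ι → ℝ) → Set Ω := fun V => {ω | n * ε ^ 2 / (512 * c ^ 2) <
    1 / (8 * c ^ 2) * ∑ i, inner ℝ (f V (Y i ω)) (X i ω - g (Y i ω))
      - (1 / (8 * c ^ 2)) ^ 2 * c ^ 2 / 2 * ∑ i, ‖f V (Y i ω)‖ ^ 2}
  have hBad : ∀ V, P (Bad V) ≤ ENNReal.ofReal (Real.exp (-(n * ε ^ 2 / (512 * c ^ 2)))) :=
    fun V => hS.measure_lt_sum_inner_le hg hc (hf V) _ _
  have hsub : {ω | ∃ V, (l0 V : ℝ) ≤ κ ∧ l2 V ≤ R ∧ n * ε ^ 2 ≤ ∑ i, ‖f V (Y i ω)‖ ^ 2 ∧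
        3 / 8 * ∑ i, ‖f V (Y i ω)‖ ^ 2 <
          ∑ i, inner ℝ (f V (Y i ω)) (X i ω - g (Y i ω))} ⊆
      {ω | n * q ^ 2 * c ^ 2 < ∑ i, ‖X i ω - g (Y i ω)‖ ^ 2} ∪ ⋃ V ∈ T, Bad V := by
    rintro ω ⟨V, hV0, hV2, hVε, hVbad⟩
    by_contra hω
    simp only [Set.mem_union, Set.mem_ofPred_eq, not_or, not_lt, Set.mem_iUnion, not_exists] at hω
    obtain ⟨hω1, hω2⟩ := hω
    have hξ : ∑ i, ‖X i ω - g (Y i ω)‖ ^ 2 ≤ n * B ^ 2 := by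
      rw [hB, mul_pow, ← mul_assoc]; exact hω1
    refine absurd hVbad (not_lt.2 ?_)
    rcases le_total (4 * B) ε with h | h
    · exact sum_inner_le_of_large hξ hB0.le h hVε
    · obtain ⟨V', hV'T, hle, hnear⟩ := hT V (Nat.le_floor hV0)
        fun j => (abs_apply_le_l2 V j).trans hV2
      have h2 : l2 (V - V') ≤ √q * a := by
        rw [l2, ← Real.sqrt_sq ha0.le, ← Real.sqrt_mul hqR.le]
        apply Real.sqrt_le_sqrt
        calc ∑ j, (V - V') j ^ 2 ≤ ∑ j : ι, a ^ 2 :=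
              Finset.sum_le_sum fun j _ => by
                rw [← sq_abs]
                exact pow_le_pow_left₀ (abs_nonneg _) (hnear j) 2
          _ = q * a ^ 2 := by simp [hq]
      refine sum_inner_le_of_near (f' := fun i => f V' (Y i ω)) hξ hB0 hε h hVε (fun i => ?_) ?_
      · refine (hlip V V' hV2 ((l2_le_l2 hle).trans hV2) _).trans ?_
        have hsq := Real.sqrt_pos.2 hqR
        calc Ls * l2 (V - V') ≤ Ls * (√q * a) := by gcongr
          _ = ε ^ 2 / (16 * B) := by rw [ha]; field_simp
      · have h3 := hω2 V' hV'T
        simp only [Bad, Set.mem_ofPred_eq, not_lt] at h3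
        have hc2 : 0 < 8 * c ^ 2 := by positivity
        have h4 := mul_le_mul_of_nonneg_left h3 hc2.le
        have e1 : 8 * c ^ 2 * (1 / (8 * c ^ 2) * ∑ i, inner ℝ (f V' (Y i ω)) (X i ω - g (Y i ω))
            - (1 / (8 * c ^ 2)) ^ 2 * c ^ 2 / 2 * ∑ i, ‖f V' (Y i ω)‖ ^ 2)
            = ∑ i, inner ℝ (f V' (Y i ω)) (X i ω - g (Y i ω))
              - 1 / 16 * ∑ i, ‖f V' (Y i ω)‖ ^ 2 := by field_simp; ring
        have e2 : 8 * c ^ 2 * (n * ε ^ 2 / (512 * c ^ 2)) = n * ε ^ 2 / 64 := by field_simp; ring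
        rw [e1, e2] at h4
        linarith
  refine (measure_mono hsub).trans ((measure_union_le _ _).trans ?_)
  gcongr
  · exact hS.measure_sum_norm_sq_le hg hc hc0 hq0 hd hn
  · calc P (⋃ V ∈ T, Bad V) ≤ ∑ V ∈ T, P (Bad V) := measure_biUnion_finset_le _ _
      _ ≤ ∑ V ∈ T, ENNReal.ofReal (Real.exp (-(n * ε ^ 2 / (512 * c ^ 2)))) :=
        Finset.sum_le_sum fun V _ => hBad V
      _ ≤ _ := by
        rw [Finset.sum_const, nsmul_eq_mul, ← ENNReal.ofReal_natCast,
          ← ENNReal.ofReal_mul (Nat.cast_nonneg _)]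
        apply ENNReal.ofReal_le_ofReal
        gcongr

end Noise

/-! ### Bounds on random integrals -/

section Fubini

variable {Ω Θ : Type*} [MeasurableSpace Ω] [MeasurableSpace Θ] {P : Measure Ω}
  [IsProbabilityMeasure P]

theorem measure_lt_setLIntegral_le {ν : Measure Θ} [SFinite ν] {F : Θ → Ω → ℝ≥0∞}
    (hF : Measurable (Function.uncurry F)) (hF1 : ∀ θ, ∫⁻ ω, F θ ω ∂P ≤ 1) {A : Set Θ} {b t : ℝ}
    (hA : ν A ≤ ENNReal.ofReal b) (hb : 0 < b) (ht : 0 < t) :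
    P {ω | ENNReal.ofReal (t * b) < ∫⁻ θ in A, F θ ω ∂ν} ≤ ENNReal.ofReal (1 / t) := by
  have hm : Measurable fun ω => ∫⁻ θ in A, F θ ω ∂ν :=
    Measurable.lintegral_prod_right' (f := fun p : Ω × Θ => F p.2 p.1) (hF.comp measurable_swap)
  have h1 : ∫⁻ ω, ∫⁻ θ in A, F θ ω ∂ν ∂P ≤ ENNReal.ofReal b := by
    rw [lintegral_lintegral_swap (f := fun ω θ => F θ ω) (hF.comp measurable_swap).aemeasurable]
    calc _ ≤ ∫⁻ _ in A, 1 ∂ν := lintegral_mono hF1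
      _ ≤ _ := by rwa [setLIntegral_one]
  have h5 := meas_ge_le_lintegral_div hm.aemeasurable (μ := P) (ε := ENNReal.ofReal (t * b))
    (by simpa using mul_pos ht hb) (by simp)
  have h6 : ENNReal.ofReal b / ENNReal.ofReal (t * b) = ENNReal.ofReal (1 / t) := by
    rw [← ENNReal.ofReal_div_of_pos (mul_pos ht hb)]
    congr 1
    field_simp
  rw [← h6]
  refine (measure_mono ?_).trans (h5.trans (ENNReal.div_le_div_right h1 _))
  intro ω hω
  simp only [Set.mem_ofPred_eq] at hω ⊢
  exact hω.le

/-- If the integrand is unlikely to be small at each point, then by Markov's inequality it is large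
on half of the domain of integration with high probability. -/
theorem measure_setLIntegral_exp_lt_le {μ : Measure Θ} [IsFiniteMeasure μ] {Φ : Θ → Ω → ℝ}
    (hΦ : Measurable (Function.uncurry Φ)) {A : Set Θ} (hA : MeasurableSet A) {β τ p : ℝ}
    (hβ : 0 < β) (hβA : ENNReal.ofReal β ≤ μ A)
    (hτ : ∀ θ ∈ A, P {ω | Φ θ ω < τ} ≤ ENNReal.ofReal p) :
    P {ω | ∫⁻ θ in A, ENNReal.ofReal (Real.exp (Φ θ ω)) ∂μ <
      ENNReal.ofReal (β / 2 * Real.exp τ)} ≤ ENNReal.ofReal (2 * p) := by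
  have hA0 : μ A ≠ 0 := fun h => by
    rw [h, nonpos_iff_eq_zero, ENNReal.ofReal_eq_zero] at hβA; linarith
  have hAt : μ A ≠ ∞ := measure_ne_top μ A
  let S : Set (Ω × Θ) := {x | Φ x.2 x.1 < τ}
  have hS : MeasurableSet S := measurableSet_lt (hΦ.comp measurable_swap) measurable_const
  have hmS : Measurable fun ω => (μ.restrict A) (Prod.mk ω ⁻¹' S) :=
    measurable_measure_prodMk_left hS
  have h1 : ∫⁻ ω, (μ.restrict A) (Prod.mk ω ⁻¹' S) ∂P ≤ ENNReal.ofReal p * μ A := by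
    rw [← Measure.prod_apply hS, Measure.prod_apply_symm hS]
    calc _ ≤ ∫⁻ _ in A, ENNReal.ofReal p ∂μ := setLIntegral_mono' hA fun θ hθ => hτ θ hθ
      _ = _ := setLIntegral_const _ _
  have h5 := meas_ge_le_lintegral_div hmS.aemeasurable (μ := P) (ε := μ A / 2)
    (by simpa using hA0) (ENNReal.div_ne_top hAt (by norm_num))
  calc _ ≤ P {ω | μ A / 2 ≤ (μ.restrict A) (Prod.mk ω ⁻¹' S)} := by
        apply measure_mono
        intro ω hω
        by_contra hlt
        simp only [Set.mem_ofPred_eq, not_le] at hω hlt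
        refine absurd hω (not_lt.2 ?_)
        have hSω : MeasurableSet (Prod.mk ω ⁻¹' S) := measurable_prodMk_left hS
        have hge : μ A / 2 ≤ (μ.restrict A) (Prod.mk ω ⁻¹' S)ᶜ := by
          have h6 := measure_add_measure_compl (μ := μ.restrict A) hSω
          rw [Measure.restrict_apply_univ] at h6
          by_contra h7
          have := ENNReal.add_lt_add hlt (not_le.1 h7)
          rw [h6, ENNReal.add_halves] at this
          exact lt_irrefl _ this
        calc ENNReal.ofReal (β / 2 * Real.exp τ)
            = ENNReal.ofReal (Real.exp τ) * (ENNReal.ofReal β / 2) := by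
              rw [mul_comm, ENNReal.ofReal_mul (Real.exp_nonneg _),
                ENNReal.ofReal_div_of_pos (by norm_num)]
              simp
          _ ≤ ENNReal.ofReal (Real.exp τ) * (μ.restrict A) (Prod.mk ω ⁻¹' S)ᶜ := by
              gcongr
              exact (ENNReal.div_le_div_right hβA _).trans hge
          _ = ∫⁻ _ in (Prod.mk ω ⁻¹' S)ᶜ, ENNReal.ofReal (Real.exp τ) ∂(μ.restrict A) := by
              rw [setLIntegral_const]
          _ ≤ ∫⁻ θ in (Prod.mk ω ⁻¹' S)ᶜ, ENNReal.ofReal (Real.exp (Φ θ ω)) ∂(μ.restrict A) := by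
              refine setLIntegral_mono' hSω.compl fun θ hθ => ?_
              apply ENNReal.ofReal_le_ofReal
              apply Real.exp_le_exp.2
              simpa [S] using hθ
          _ ≤ _ := setLIntegral_le_lintegral _ _
    _ ≤ ENNReal.ofReal p * μ A / (μ A / 2) := h5.trans (ENNReal.div_le_div_right h1 _)
    _ = ENNReal.ofReal (2 * p) := by
        rw [ENNReal.ofReal_mul (by norm_num), mul_div_assoc, mul_comm]
        congr 1
        rw [ENNReal.div_eq_inv_mul, ENNReal.inv_div (by simp) (by simp), mul_comm,
          ENNReal.mul_div_cancel hA0 hAt]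
        simp

end Fubini

/-! ### The likelihood ratio -/

/-- Logarithm of the likelihood ratio between a regression function and the true one, when they
differ by `f i` at the `i`-th design point and the noise is `ξ i`. -/
noncomputable def logRatio {n : ℕ} {E : Type*} [NormedAddCommGroup E] [InnerProductSpace ℝ E]
    (σ : ℝ) (ξ f : Fin n → E) : ℝ :=
  (∑ i, inner ℝ (f i) (ξ i)) / σ ^ 2 - (∑ i, ‖f i‖ ^ 2) / (2 * σ ^ 2)

/-- The approximation error `g_V - g`, set to `0` outside of `Yset`. The Lipschitz condition only
holds on `Yset`, and it is what makes the error jointly measurable in `V` and the design point. -/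
noncomputable def residual {ι : Type*} {dx dy : ℕ} (Yset : Set (EuclideanSpace ℝ (Fin dy)))
    (gW : (ι → ℝ) → EuclideanSpace ℝ (Fin dy) → EuclideanSpace ℝ (Fin dx))
    (g : EuclideanSpace ℝ (Fin dy) → EuclideanSpace ℝ (Fin dx)) (V : ι → ℝ) :
    EuclideanSpace ℝ (Fin dy) → EuclideanSpace ℝ (Fin dx) :=
  Yset.indicator fun y => gW V y - g y

section Residual

variable {ι : Type*} {dx dy : ℕ} {Yset : Set (EuclideanSpace ℝ (Fin dy))}
  {gW : (ι → ℝ) → EuclideanSpace ℝ (Fin dy) → EuclideanSpace ℝ (Fin dx)}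
  {g : EuclideanSpace ℝ (Fin dy) → EuclideanSpace ℝ (Fin dx)} {L : ℝ → ℝ}

theorem measurable_residual (hY : MeasurableSet Yset) (hgW : ∀ W, Measurable (gW W))
    (hg : Measurable g) (V : ι → ℝ) : Measurable (residual Yset gW g V) :=
  ((hgW V).sub hg).indicator hY

variable [Fintype ι]

theorem LocallyLipschitzClass.norm_residual_sub_le (hL : LocallyLipschitzClass Yset gW L) {η : ℝ}
    (hη : 0 < η) {V V' : ι → ℝ} (hV : l2 V ≤ η) (hV' : l2 V' ≤ η)
    (y : EuclideanSpace ℝ (Fin dy)) :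
    ‖residual Yset gW g V y - residual Yset gW g V' y‖ ≤ L η * l2 (V - V') := by
  by_cases hy : y ∈ Yset
  · simp only [residual, Set.indicator_of_mem hy, sub_sub_sub_cancel_right]
    exact (hL η hη).2 V V' (max_le hV hV') y hy
  · simp only [residual, Set.indicator_of_notMem hy, sub_self, norm_zero]
    exact mul_nonneg (zero_le_one.trans (hL η hη).1) (l2_nonneg _)

theorem continuous_l2 : Continuous (l2 : (ι → ℝ) → ℝ) := by
  unfold l2; fun_prop

theorem LocallyLipschitzClass.continuous_residual (hL : LocallyLipschitzClass Yset gW L)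
    (y : EuclideanSpace ℝ (Fin dy)) : Continuous fun V => residual Yset gW g V y := by
  rw [continuous_iff_continuousAt]
  intro V₀
  have hη : 0 < l2 V₀ + 1 := by have := l2_nonneg V₀; linarith
  rw [ContinuousAt, tendsto_iff_norm_sub_tendsto_zero]
  have hev : ∀ᶠ V in nhds V₀, l2 V ≤ l2 V₀ + 1 :=
    (continuous_l2.tendsto V₀).eventually_le_const (by linarith)
  have hlim : Filter.Tendsto (fun V => L (l2 V₀ + 1) * l2 (V - V₀)) (nhds V₀) (nhds 0) := by
    have hc : Continuous fun V : ι → ℝ => L (l2 V₀ + 1) * l2 (V - V₀) :=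
      continuous_const.mul (continuous_l2.comp (continuous_id.sub continuous_const))
    have := hc.tendsto V₀
    simpa [l2] using this
  refine squeeze_zero' (Filter.Eventually.of_forall fun _ => norm_nonneg _) ?_ hlim
  filter_upwards [hev] with V hV
  exact hL.norm_residual_sub_le hη hV (by linarith) y

theorem LocallyLipschitzClass.measurable_uncurry_residual (hL : LocallyLipschitzClass Yset gW L)
    (hY : MeasurableSet Yset) (hgW : ∀ W, Measurable (gW W)) (hg : Measurable g) :
    Measurable (Function.uncurry (residual Yset gW g)) :=
  measurable_uncurry_of_continuous_of_measurable hL.continuous_residual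
    (measurable_residual hY hgW hg)

end Residual

section Ratio

variable {Ω : Type*} [MeasurableSpace Ω] {P : Measure Ω} [IsProbabilityMeasure P] {n dx dy : ℕ}
  {Yset : Set (EuclideanSpace ℝ (Fin dy))}
  {g : EuclideanSpace ℝ (Fin dy) → EuclideanSpace ℝ (Fin dx)}
  {X : Fin n → Ω → EuclideanSpace ℝ (Fin dx)} {Y : Fin n → Ω → EuclideanSpace ℝ (Fin dy)}
  {σs : Fin n → ℝ} {c σ : ℝ}

/-- Since `σ` overestimates the noise level, the likelihood ratio has expectation at most `1`. -/
theorem IsSample.lintegral_exp_logRatio_le_one (hS : IsSample P Yset g X Y σs) (hg : Measurable g)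
    (hc : ∀ i, σs i ≤ c) (hc0 : 0 < c) (hcσ : c ≤ σ)
    {h : EuclideanSpace ℝ (Fin dy) → EuclideanSpace ℝ (Fin dx)} (hh : Measurable h) :
    ∫⁻ ω, ENNReal.ofReal (Real.exp (logRatio σ (fun i => X i ω - g (Y i ω))
      fun i => h (Y i ω))) ∂P ≤ 1 := by
  refine (lintegral_mono fun ω => ?_).trans
    (hS.lintegral_exp_mul_sum_le_one hg hc hh (1 / σ ^ 2))
  apply ENNReal.ofReal_le_ofReal
  apply Real.exp_le_exp.2
  have hσ : 0 < σ := hc0.trans_le hcσ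
  have h1 : (1 / σ ^ 2) ^ 2 * c ^ 2 / 2 ≤ 1 / (2 * σ ^ 2) := by
    calc (1 / σ ^ 2) ^ 2 * c ^ 2 / 2 ≤ (1 / σ ^ 2) ^ 2 * σ ^ 2 / 2 := by gcongr
      _ = 1 / (2 * σ ^ 2) := by field_simp
  have h2 : 0 ≤ ∑ i, ‖h (Y i ω)‖ ^ 2 := Finset.sum_nonneg fun _ _ => sq_nonneg _
  have h3 := mul_le_mul_of_nonneg_right h1 h2
  rw [logRatio, div_eq_mul_one_div, mul_comm, div_eq_mul_one_div _ (2 * σ ^ 2)]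
  linarith

/-- The tilt `-3 / σ²` balances the factor lost on the exceptional probability `e^{-t}` against the
one lost on the approximation error. -/
theorem IsSample.measure_logRatio_lt_le (hS : IsSample P Yset g X Y σs) (hg : Measurable g)
    (hc : ∀ i, σs i ≤ c) (hc0 : 0 < c) (hcσ : c ≤ σ)
    {h : EuclideanSpace ℝ (Fin dy) → EuclideanSpace ℝ (Fin dx)} (hh : Measurable h) {F : ℝ}
    (hF : ∀ y, ‖h y‖ ≤ F) (t : ℝ) :
    P {ω | logRatio σ (fun i => X i ω - g (Y i ω)) (fun i => h (Y i ω)) <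
      -t / 3 - 2 * n * F ^ 2 / σ ^ 2} ≤ ENNReal.ofReal (Real.exp (-t)) := by
  refine (measure_mono ?_).trans (hS.measure_lt_sum_inner_le hg hc hh (-3 / σ ^ 2) t)
  intro ω hω
  simp only [Set.mem_ofPred_eq] at hω ⊢
  have hσ : 0 < σ := hc0.trans_le hcσ
  rw [logRatio] at hω
  set S := ∑ i, ‖h (Y i ω)‖ ^ 2 with hS'
  set I := ∑ i, inner ℝ (h (Y i ω)) (X i ω - g (Y i ω))
  have hS0 : 0 ≤ S := Finset.sum_nonneg fun _ _ => sq_nonneg _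
  have hSF : S ≤ n * F ^ 2 := by
    calc S ≤ ∑ i : Fin n, F ^ 2 :=
          Finset.sum_le_sum fun i _ => pow_le_pow_left₀ (norm_nonneg _) (hF _) 2
      _ = n * F ^ 2 := by simp
  have h1 : (-3 / σ ^ 2) ^ 2 * c ^ 2 / 2 * S ≤ 9 / 2 * (S / σ ^ 2) := by
    calc (-3 / σ ^ 2) ^ 2 * c ^ 2 / 2 * S ≤ (-3 / σ ^ 2) ^ 2 * σ ^ 2 / 2 * S := by gcongr
      _ = 9 / 2 * (S / σ ^ 2) := by field_simp; ring
  have h2 : S / σ ^ 2 ≤ n * F ^ 2 / σ ^ 2 := by gcongr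
  have h3 : -3 / σ ^ 2 * I = -3 * (I / σ ^ 2) := by ring
  have h4 : S / (2 * σ ^ 2) = S / σ ^ 2 / 2 := by field_simp
  have h5 : 2 * n * F ^ 2 / σ ^ 2 = 2 * (n * F ^ 2 / σ ^ 2) := by ring
  rw [h4, h5] at hω
  rw [h3]
  linarith

theorem measurable_mask {ι : Type*} [Finite ι] :
    Measurable fun θ : (ι → Bool) × (ι → ℝ) => mask θ.1 θ.2 := by
  rw [measurable_pi_iff]
  intro j
  have h : Measurable fun θ : (ι → Bool) × (ι → ℝ) => θ.1 j :=
    (measurable_pi_apply j).comp measurable_fst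
  exact Measurable.ite (measurableSet_eq_fun h measurable_const)
    ((measurable_pi_apply j).comp measurable_snd) measurable_const

theorem IsSample.measurable_logRatio (hS : IsSample P Yset g X Y σs) (hg : Measurable g)
    {Θ : Type*} [MeasurableSpace Θ]
    {f : Θ → EuclideanSpace ℝ (Fin dy) → EuclideanSpace ℝ (Fin dx)}
    (hf : Measurable (Function.uncurry f)) (σ : ℝ) :
    Measurable (Function.uncurry fun (θ : Θ) (ω : Ω) =>
      logRatio σ (fun i => X i ω - g (Y i ω)) fun i => f θ (Y i ω)) := by
  unfold logRatio Function.uncurry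
  have h1 : ∀ i, Measurable fun x : Θ × Ω => f x.1 (Y i x.2) := fun i =>
    hf.comp (measurable_fst.prodMk ((hS.measurable_Y i).comp measurable_snd))
  have h2 : ∀ i, Measurable fun x : Θ × Ω => g (Y i x.2) := fun i =>
    (hS.measurable_comp_Y hg i).comp measurable_snd
  have h3 : ∀ i, Measurable fun x : Θ × Ω => X i x.2 := fun i =>
    (hS.measurable_X i).comp measurable_snd
  dsimp only
  exact ((Finset.measurable_sum _ fun i _ => (h1 i).inner ((h3 i).sub (h2 i))).div_const _).sub
    ((Finset.measurable_sum _ fun i _ => (h1 i).norm.pow_const 2).div_const _)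

end Ratio

section Posterior

variable {ι : Type*} {n dx dy : ℕ}

theorem likelihood_eq (gW : (ι → ℝ) → EuclideanSpace ℝ (Fin dy) → EuclideanSpace ℝ (Fin dx))
    (g : EuclideanSpace ℝ (Fin dy) → EuclideanSpace ℝ (Fin dx)) (σ : ℝ)
    (x : Fin n → EuclideanSpace ℝ (Fin dx)) (y : Fin n → EuclideanSpace ℝ (Fin dy))
    (W : ι → ℝ) :
    likelihood gW σ x y W = Real.exp (-(1 / (2 * σ ^ 2)) * ∑ i, ‖x i - g (y i)‖ ^ 2) *
      Real.exp (logRatio σ (fun i => x i - g (y i)) fun i => gW W (y i) - g (y i)) := by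
  rw [likelihood, ← Real.exp_add, logRatio]
  congr 1
  have h : ∀ i, ‖x i - gW W (y i)‖ ^ 2 = ‖x i - g (y i)‖ ^ 2
      - 2 * inner ℝ (gW W (y i) - g (y i)) (x i - g (y i)) + ‖gW W (y i) - g (y i)‖ ^ 2 := by
    intro i
    rw [real_inner_comm, ← norm_sub_sq_real]
    congr 2
    abel
  simp_rw [h]
  rw [Finset.sum_add_distrib, Finset.sum_sub_distrib, ← Finset.mul_sum]
  ring

variable [Fintype ι] [DecidableEq ι]

theorem spikeSlabPosterior_le [Nonempty ι]
    (gW : (ι → ℝ) → EuclideanSpace ℝ (Fin dy) → EuclideanSpace ℝ (Fin dx))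
    (g : EuclideanSpace ℝ (Fin dy) → EuclideanSpace ℝ (Fin dx)) (u ρ₀ σ : ℝ)
    (x : Fin n → EuclideanSpace ℝ (Fin dx)) (y : Fin n → EuclideanSpace ℝ (Fin dy))
    (A : Set ((ι → Bool) × (ι → ℝ))) {N D : ℝ} (hD0 : 0 < D)
    (hD : ENNReal.ofReal D ≤ ∫⁻ θ, ENNReal.ofReal (Real.exp (logRatio σ
      (fun i => x i - g (y i)) fun i => gW (mask θ.1 θ.2) (y i) - g (y i))) ∂spikeSlabPrior u ρ₀)
    (hN : ∫⁻ θ in A, ENNReal.ofReal (Real.exp (logRatio σ (fun i => x i - g (y i))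
      fun i => gW (mask θ.1 θ.2) (y i) - g (y i))) ∂spikeSlabPrior u ρ₀ ≤ ENNReal.ofReal N) :
    spikeSlabPosterior gW u ρ₀ σ x y A ≤ ENNReal.ofReal (N / D) := by
  have hun : ∀ B, spikeSlabUnnormalized gW u ρ₀ σ x y B =
      ENNReal.ofReal (Real.exp (-(1 / (2 * σ ^ 2)) * ∑ i, ‖x i - g (y i)‖ ^ 2)) *
        ∫⁻ θ in B, ENNReal.ofReal (Real.exp (logRatio σ (fun i => x i - g (y i))
          fun i => gW (mask θ.1 θ.2) (y i) - g (y i))) ∂spikeSlabPrior u ρ₀ := by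
    intro B
    rw [spikeSlabUnnormalized, withDensity_apply', ← lintegral_const_mul' _ _ (by simp)]
    simp_rw [likelihood_eq gW g, ENNReal.ofReal_mul (Real.exp_nonneg _)]
  rw [spikeSlabPosterior, Measure.smul_apply, smul_eq_mul, hun, hun, ← ENNReal.div_eq_inv_mul,
    ENNReal.mul_div_mul_left _ _ (by simp [Real.exp_pos]) (by simp), Measure.restrict_univ,
    ENNReal.ofReal_div_of_pos hD0]
  exact ENNReal.div_le_div hN hD

end Posterior

/-! ### Lower bound on the evidence -/

section Evidence

variable {ι : Type*} [Fintype ι]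

theorem l2_le_sqrt_activeCount_mul {Λ : ι → Bool} {V : ι → ℝ} {b : ℝ} (hb : 0 ≤ b)
    (hV : ∀ j, |V j| ≤ if Λ j = true then b else 0) : l2 V ≤ √(activeCount Λ) * b := by
  rw [l2, ← Real.sqrt_sq hb, ← Real.sqrt_mul (Nat.cast_nonneg _)]
  apply Real.sqrt_le_sqrt
  calc ∑ j, V j ^ 2 ≤ ∑ j, if Λ j = true then b ^ 2 else 0 := by
        refine Finset.sum_le_sum fun j _ => ?_
        have h := pow_le_pow_left₀ (abs_nonneg _) (hV j) 2
        rw [sq_abs] at h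
        by_cases hj : Λ j = true <;> simp_all
    _ = _ := by rw [← Finset.sum_filter, Finset.sum_const, nsmul_eq_mul, activeCount]

theorem l0_mask_le (Λ : ι → Bool) (W : ι → ℝ) : l0 (mask Λ W) ≤ activeCount Λ := by
  rw [l0, activeCount, ← Set.ncard_coe_finset]
  refine Set.ncard_le_ncard (fun j hj => ?_) (Set.toFinite _)
  by_contra h
  simp_all [mask]

variable [DecidableEq ι] {Ω : Type*} [MeasurableSpace Ω] {P : Measure Ω} [IsProbabilityMeasure P] {n dx dy : ℕ}
  {Yset : Set (EuclideanSpace ℝ (Fin dy))}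
  {g : EuclideanSpace ℝ (Fin dy) → EuclideanSpace ℝ (Fin dx)}
  {X : Fin n → Ω → EuclideanSpace ℝ (Fin dx)} {Y : Fin n → Ω → EuclideanSpace ℝ (Fin dy)}
  {σs : Fin n → ℝ} {c σ : ℝ}

/-- The evidence is at least the contribution of the weights that have one given sparsity
structure and are close to a given reference point. -/
theorem IsSample.measure_evidence_lt_le [Nonempty ι] (hS : IsSample P Yset g X Y σs)
    (hg : Measurable g) (hc : ∀ i, σs i ≤ c) (hc0 : 0 < c) (hcσ : c ≤ σ)
    {f : (ι → ℝ) → EuclideanSpace ℝ (Fin dy) → EuclideanSpace ℝ (Fin dx)}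
    (hf : Measurable (Function.uncurry f)) (u ρ₀ : ℝ) (Λ : ι → Bool) {w : ι → ℝ}
    (hw : ∀ j, |w j| ≤ 1) {a F : ℝ} (ha0 : 0 < a) (ha1 : a ≤ 1)
    (hF : ∀ W : ι → ℝ, (∀ j, Λ j = true → |W j - w j| ≤ a) → ∀ y, ‖f (mask Λ W) y‖ ≤ F) (t : ℝ) :
    P {ω | ∫⁻ θ, ENNReal.ofReal (Real.exp (logRatio σ (fun i => X i ω - g (Y i ω))
      fun i => f (mask θ.1 θ.2) (Y i ω))) ∂spikeSlabPrior u ρ₀ <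
      ENNReal.ofReal (structurePrior u Λ *
        ((a / 10) ^ activeCount Λ / 2 * Real.exp (-t / 3 - 2 * n * F ^ 2 / σ ^ 2)))} ≤
    ENNReal.ofReal (2 * Real.exp (-t)) := by
  let A : Set (ι → ℝ) :=
    Set.univ.pi fun j => if Λ j = true then Set.Icc (w j - a) (w j + a) else Set.univ
  have hA : MeasurableSet A := by
    refine MeasurableSet.univ_pi fun j => ?_
    by_cases h : Λ j = true
    · simp only [h, if_true]; exact measurableSet_Icc
    · simp [h]
  have hAF : ∀ W ∈ A, ∀ y, ‖f (mask Λ W) y‖ ≤ F := by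
    intro W hW
    refine hF W fun j hj => ?_
    have := hW j (Set.mem_univ j)
    simp only [hj, if_true, Set.mem_Icc] at this
    rw [abs_le]
    constructor <;> linarith [this.1, this.2]
  have hmaskΛ : Measurable fun W : ι → ℝ => mask Λ W := measurable_mask.comp measurable_prodMk_left
  have hfΛ : Measurable (Function.uncurry fun (W : ι → ℝ) => f (mask Λ W)) :=
    hf.comp ((hmaskΛ.comp measurable_fst).prodMk measurable_snd)
  have hfV : ∀ V, Measurable (f V) := fun V => hf.comp measurable_prodMk_left
  refine (measure_mono ?_).trans (measure_setLIntegral_exp_lt_le (μ := weightPrior ρ₀ Λ)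
    (hS.measurable_logRatio hg hfΛ σ) hA (by positivity)
    (div_ten_pow_le_weightPrior ρ₀ Λ hw ha0.le ha1)
    (fun W hW => hS.measure_logRatio_lt_le hg hc hc0 hcσ (hfV _) (hAF W hW) t))
  intro ω hω
  simp only [Set.mem_ofPred_eq] at hω ⊢
  by_contra h
  refine absurd hω (not_lt.2 ?_)
  rw [lintegral_spikeSlabPrior, ENNReal.ofReal_mul (structurePrior_nonneg u Λ)]
  refine le_trans ?_ (Finset.single_le_sum (f := fun Λ => ENNReal.ofReal (structurePrior u Λ) *
    ∫⁻ W, ENNReal.ofReal (Real.exp (logRatio σ (fun i => X i ω - g (Y i ω))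
      fun i => f (mask Λ W) (Y i ω))) ∂weightPrior ρ₀ Λ) (fun _ _ => zero_le) (Finset.mem_univ Λ))
  gcongr
  exact (not_lt.1 h).trans (setLIntegral_le_lintegral _ _)

end Evidence

/-! ### Arithmetic of the rate -/

/-- The union bound over the grid: the sieve radius `√s b_s` and the mesh of the grid only enter
through their ratio, in which the powers of `s` cancel. The constant is `12800 = 512 * 25`, where
`1 / 512` comes from the Chernoff bound and `25 = 6 * 4 + 1` from the `6s` active entries, the
factor `q ^ 4` for each of them, and the final `1 / q`. -/
theorem card_net_mul_exp_le {q n : ℕ} {u σ c s ε Ls : ℝ} (hu : 1 ≤ u) (hc0 : 0 < c) (hcσ : c ≤ σ)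
    (hs : 1 ≤ s) (hq : 3 ≤ q) (hn : 1 ≤ n) (hLs : 1 ≤ Ls) (hl1 : 1 ≤ Real.log q)
    (hσl : 1 ≤ σ ^ 2 * Real.log q) (hε : 0 < ε)
    (hnε : n * ε ^ 2 = 12800 * (u * σ ^ 2 * s * (Real.log q + Real.log Ls)
      + c ^ 2 * s * Real.log n)) :
    (q * (2 * (√s * √(2 * (1 + u) * (1 + s) * Real.log q) /
      (ε ^ 2 / (16 * (q * c)) / (Ls * √q))) + 1)) ^ ⌊6 * s⌋₊ *
      Real.exp (-(n * ε ^ 2 / (512 * c ^ 2))) ≤ 1 / q := by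
  set l := Real.log q with hl
  set R := √s * √(2 * (1 + u) * (1 + s) * l) with hR
  have hq3 : (3 : ℝ) ≤ q := by exact_mod_cast hq
  have hn1 : (1 : ℝ) ≤ n := by exact_mod_cast hn
  have hlam : 0 ≤ Real.log Ls := Real.log_nonneg hLs
  have hln : 0 ≤ Real.log n := Real.log_nonneg hn1
  have hσ : 0 < σ := hc0.trans_le hcσ
  have hR0 : 0 ≤ R := by positivity
  have hR2 : R ^ 2 ≤ 8 * u * s ^ 2 * l := by
    rw [hR, mul_pow, Real.sq_sqrt (by linarith), Real.sq_sqrt (by positivity)]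
    have h1 : (1 + u) * (1 + s) ≤ 2 * u * (2 * s) := by gcongr <;> linarith
    nlinarith [mul_le_mul_of_nonneg_left h1 (show 0 ≤ 2 * s * l by positivity)]
  have hnε1 : 12800 * (u * σ ^ 2 * s * l) ≤ n * ε ^ 2 := by
    rw [hnε]
    have h1 : 0 ≤ u * σ ^ 2 * s * Real.log Ls := by positivity
    have h2 : 0 ≤ c ^ 2 * s * Real.log n := by positivity
    linarith
  -- the radius of the sieve is negligible compared with the mesh, up to powers of `q` and `n`
  have hRc : 16 * R * c ≤ n * ε ^ 2 := by
    refine le_trans ?_ hnε1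
    refine (sq_le_sq₀ (by positivity) (by positivity)).1 ?_
    calc (16 * R * c) ^ 2 = 256 * c ^ 2 * R ^ 2 := by ring
      _ ≤ 256 * σ ^ 2 * (8 * u * s ^ 2 * l) := by gcongr
      _ = 2048 * (u * s ^ 2 * (σ ^ 2 * l)) * 1 * 1 := by ring
      _ ≤ 163840000 * (u * s ^ 2 * (σ ^ 2 * l)) * u * (σ ^ 2 * l) := by gcongr; norm_num
      _ = _ := by ring
  have hratio : R / (ε ^ 2 / (16 * (q * c)) / (Ls * √q)) ≤ q ^ 2 * Ls * n := by
    have hsq : √(q : ℝ) ≤ q := by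
      rw [Real.sqrt_le_left (by linarith)]
      nlinarith
    calc R / (ε ^ 2 / (16 * (q * c)) / (Ls * √q)) = q * √q * Ls * (16 * R * c / ε ^ 2) := by
          field_simp
      _ ≤ q * q * Ls * n := by
          gcongr
          rw [div_le_iff₀ (by positivity)]
          exact hRc
      _ = _ := by ring
  have hbase : q * (2 * (R / (ε ^ 2 / (16 * (q * c)) / (Ls * √q))) + 1) ≤
      Real.exp (4 * l + Real.log Ls + Real.log n) := by
    rw [Real.exp_add, Real.exp_add, Real.exp_log (by linarith), Real.exp_log (by linarith),
      show (4 : ℝ) * l = ((4 : ℕ) : ℝ) * l by norm_num, Real.exp_nat_mul, hl,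
      Real.exp_log (by linarith)]
    have h1 : (1 : ℝ) ≤ q ^ 2 * Ls * n :=
      one_le_mul_of_one_le_of_one_le
        (one_le_mul_of_one_le_of_one_le (one_le_pow₀ (by linarith)) hLs) hn1
    calc (q : ℝ) * (2 * (R / (ε ^ 2 / (16 * (q * c)) / (Ls * √q))) + 1)
        ≤ q * (2 * (q ^ 2 * Ls * n) + q ^ 2 * Ls * n) := by gcongr
      _ = q * (3 * (q ^ 2 * Ls * n)) := by ring
      _ ≤ q * (q * (q ^ 2 * Ls * n)) := by gcongr
      _ = _ := by ring
  have hnonneg : 0 ≤ q * (2 * (R / (ε ^ 2 / (16 * (q * c)) / (Ls * √q))) + 1) := by positivity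
  have hm : (⌊6 * s⌋₊ : ℝ) ≤ 6 * s := Nat.floor_le (by linarith)
  have hexp : 25 * (s * (l + Real.log Ls) + s * Real.log n) ≤ n * ε ^ 2 / (512 * c ^ 2) := by
    rw [le_div_iff₀ (by positivity), hnε]
    have h1 : c ^ 2 * (s * (l + Real.log Ls)) ≤ u * σ ^ 2 * (s * (l + Real.log Ls)) := by
      gcongr
      calc c ^ 2 ≤ σ ^ 2 := by gcongr
        _ ≤ u * σ ^ 2 := le_mul_of_one_le_left (by positivity) hu
    nlinarith
  calc _ ≤ Real.exp (4 * l + Real.log Ls + Real.log n) ^ ⌊6 * s⌋₊ *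
        Real.exp (-(n * ε ^ 2 / (512 * c ^ 2))) := by gcongr
    _ = Real.exp (⌊6 * s⌋₊ * (4 * l + Real.log Ls + Real.log n) - n * ε ^ 2 / (512 * c ^ 2)) := by
        rw [← Real.exp_nat_mul, ← Real.exp_add, sub_eq_add_neg]
    _ ≤ Real.exp (-l) := by
        apply Real.exp_le_exp.2
        have h1 : (⌊6 * s⌋₊ : ℝ) * (4 * l + Real.log Ls + Real.log n) ≤
            6 * s * (4 * l + Real.log Ls + Real.log n) := by gcongr
        have h2 : l ≤ s * l := le_mul_of_one_le_left (by linarith) hs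
        have h3 : 0 ≤ s * Real.log Ls := by positivity
        have h4 : 0 ≤ s * Real.log n := by positivity
        linarith
    _ = 1 / q := by rw [Real.exp_neg, hl, Real.exp_log (by linarith), one_div]

/-- The radius `a = σ √(log q) / (7 L⋆ √n)` of the box around the reference weights makes the prior
mass of the box at least `(L⋆ √n)^{-s⋆}`, at a cost in the likelihood of at most `q^{-s⋆ / 12}`. -/
theorem exp_le_evidence_bound {n k : ℕ} {u σ l Lst sst ϖ s a : ℝ} (hσ : 0 < σ)
    (hl : 0 < l) (hn : 1 ≤ n) (hLst : 1 ≤ Lst) (hk : (k : ℝ) ≤ sst) (hu : 1 ≤ u) (hsst : 1 ≤ sst)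
    (hσl : 70 ≤ σ * √l) (ha : a = σ * √l / (7 * (Lst * √n)))
    (hs : s = (1 + Real.log (Lst * √n) / (u * l)) * sst + 4 * n * ϖ ^ 2 / (σ ^ 2 * u * l)) :
    Real.exp (-(((u + 1) * s + s / 12 + 1 / 3) * l + Real.log 6)) ≤
      Real.exp (-(u + 1) * l) ^ k / 3 * ((a / 10) ^ k / 2 *
        Real.exp (-l / 3 - 2 * n * (ϖ + Lst * (√sst * a)) ^ 2 / σ ^ 2)) := by
  have hn1 : (1 : ℝ) ≤ n := by exact_mod_cast hn
  have hsn : 1 ≤ √(n : ℝ) := Real.one_le_sqrt.2 hn1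
  have hLn : 1 ≤ Lst * √n := one_le_mul_of_one_le_of_one_le hLst hsn
  set μ := Real.log (Lst * √n) with hμ
  have hμ0 : 0 ≤ μ := Real.log_nonneg hLn
  have ha10 : Real.exp (-μ) ≤ a / 10 := by
    rw [Real.exp_neg, hμ, Real.exp_log (by linarith), ha, div_div, inv_eq_one_div,
      div_le_div_iff₀ (by linarith) (by linarith)]
    nlinarith
  have husl : u * s * l = u * sst * l + μ * sst + 4 * n * ϖ ^ 2 / σ ^ 2 := by
    rw [hs]
    have : u ≠ 0 := by linarith
    field_simp
  have hss : sst ≤ s := by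
    rw [hs]
    have h1 : 0 ≤ μ / (u * l) * sst := by positivity
    have h2 : 0 ≤ 4 * n * ϖ ^ 2 / (σ ^ 2 * u * l) := by positivity
    linarith
  have hF : 2 * n * (ϖ + Lst * (√sst * a)) ^ 2 / σ ^ 2 ≤
      4 * n * ϖ ^ 2 / σ ^ 2 + sst * l / 12 := by
    have h1 : (Lst * (√sst * a)) ^ 2 = sst * l * σ ^ 2 / (49 * n) := by
      have h2 : Lst * (√sst * a) = √sst * (σ * √l) / (7 * √n) := by
        rw [ha]; field_simp
      rw [h2, div_pow, mul_pow, mul_pow, mul_pow, Real.sq_sqrt (by linarith), Real.sq_sqrt hl.le,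
        Real.sq_sqrt (by linarith)]
      ring
    calc 2 * n * (ϖ + Lst * (√sst * a)) ^ 2 / σ ^ 2
        ≤ 2 * n * (2 * (ϖ ^ 2 + (Lst * (√sst * a)) ^ 2)) / σ ^ 2 := by
          gcongr
          exact add_sq_le
      _ = 4 * n * ϖ ^ 2 / σ ^ 2 + 4 / 49 * (sst * l) := by
          rw [h1]; field_simp; ring
      _ ≤ _ := by nlinarith [mul_nonneg (zero_le_one.trans hsst) hl.le]
  calc Real.exp (-(((u + 1) * s + s / 12 + 1 / 3) * l + Real.log 6))
      ≤ Real.exp (k * (-(u + 1) * l) + k * (-μ) + (-l / 3 -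
          2 * n * (ϖ + Lst * (√sst * a)) ^ 2 / σ ^ 2) + -Real.log 6) := by
        apply Real.exp_le_exp.2
        have h1 : (k : ℝ) * ((u + 1) * l + μ) ≤ sst * ((u + 1) * l + μ) := by gcongr
        have h2 : sst * l ≤ s * l := by gcongr
        linarith
    _ = Real.exp (-(u + 1) * l) ^ k / 3 * (Real.exp (-μ) ^ k / 2 *
        Real.exp (-l / 3 - 2 * n * (ϖ + Lst * (√sst * a)) ^ 2 / σ ^ 2)) := by
        rw [Real.exp_add, Real.exp_add, Real.exp_add, Real.exp_nat_mul, Real.exp_nat_mul,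
          Real.exp_neg (Real.log 6), Real.exp_log (by norm_num)]
        ring
    _ ≤ _ := by gcongr

/-- The three parts of the numerator, on the logarithmic scale, are smaller than the evidence by a
factor of `q = e^l`. In the second line, `15 / 32` times the squared radius of the sieve is at
least `15 / 8 * (1 + u) * s * l`, whereas the evidence only costs about `(1 + u) * s * l`. -/
theorem numerator_exponents_le {u s l : ℝ} (hu : 1 ≤ u) (hs : 1 ≤ s) (hl : 20 ≤ l) :
    -(1600 * (u * s * l)) ≤ -(((u + 1) * s + s / 12 + 1 / 3) * l + Real.log 6) - l ∧
    l + (1 - u * (6 * s) * l) ≤ -(((u + 1) * s + s / 12 + 1 / 3) * l + Real.log 6) - l ∧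
    l + (4 - u * l - 15 / 32 * (2 * (1 + u) * (1 + s) * l * s)) ≤
      -(((u + 1) * s + s / 12 + 1 / 3) * l + Real.log 6) - l := by
  have hlog6 : Real.log 6 ≤ 2 := by
    rw [Real.log_le_iff_le_exp (by norm_num), show (2 : ℝ) = 1 + 1 by norm_num, Real.exp_add]
    nlinarith [Real.exp_one_gt_d9]
  have hsl : l ≤ s * l := le_mul_of_one_le_left (by linarith) hs
  have husl : s * l ≤ u * (s * l) := le_mul_of_one_le_left (by linarith) hu
  have hssl : s * l ≤ s * (s * l) := le_mul_of_one_le_left (by linarith) hs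
  have hussl : u * (s * l) ≤ u * (s * (s * l)) := by gcongr
  have hul : l ≤ u * l := le_mul_of_one_le_left (by linarith) hu
  refine ⟨by linarith, by linarith, ?_⟩
  linarith

theorem logRatio_le_neg {n : ℕ} {E : Type*} [NormedAddCommGroup E] [InnerProductSpace ℝ E]
    {σ K : ℝ} (hσ : 0 < σ) {ξ f : Fin n → E} (hK : K ≤ ∑ i, ‖f i‖ ^ 2)
    (h : ∑ i, inner ℝ (f i) (ξ i) ≤ 3 / 8 * ∑ i, ‖f i‖ ^ 2) :
    logRatio σ ξ f ≤ -(K / (8 * σ ^ 2)) := by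
  rw [logRatio]
  calc _ ≤ (3 / 8 * ∑ i, ‖f i‖ ^ 2) / σ ^ 2 - (∑ i, ‖f i‖ ^ 2) / (2 * σ ^ 2) := by gcongr
    _ = -((∑ i, ‖f i‖ ^ 2) / (8 * σ ^ 2)) := by field_simp; ring
    _ ≤ _ := by gcongr

/-! ### Posterior contraction -/

/-- Deterministic part of the contraction argument: the numerator is split according to whether
the parameter is in the sieve, has too many active entries, or is too large. -/
theorem spikeSlabPosterior_empNorm_le {n dx dy : ℕ} {ι : Type*} [Fintype ι] [DecidableEq ι]
    [Nonempty ι] {gW : (ι → ℝ) → EuclideanSpace ℝ (Fin dy) → EuclideanSpace ℝ (Fin dx)}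
    {g : EuclideanSpace ℝ (Fin dy) → EuclideanSpace ℝ (Fin dx)} {u ρ₀ σ ε κ R N D : ℝ}
    {x : Fin n → EuclideanSpace ℝ (Fin dx)} {y : Fin n → EuclideanSpace ℝ (Fin dy)}
    (hn : 1 ≤ n) (hσ : 0 < σ) (hε : 0 < ε)
    (hm : Measurable fun θ : (ι → Bool) × (ι → ℝ) => logRatio σ (fun i => x i - g (y i))
      fun i => gW (mask θ.1 θ.2) (y i) - g (y i))
    (hsieve : ∀ V, (l0 V : ℝ) ≤ κ → l2 V ≤ R → n * ε ^ 2 ≤ ∑ i, ‖gW V (y i) - g (y i)‖ ^ 2 →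
      ∑ i, inner ℝ (gW V (y i) - g (y i)) (x i - g (y i)) ≤
        3 / 8 * ∑ i, ‖gW V (y i) - g (y i)‖ ^ 2)
    (hN0 : Real.exp (-(n * ε ^ 2 / (8 * σ ^ 2))) ≤ N)
    (hN1 : ∫⁻ θ in {θ | κ < activeCount θ.1}, ENNReal.ofReal (Real.exp (logRatio σ
      (fun i => x i - g (y i)) fun i => gW (mask θ.1 θ.2) (y i) - g (y i)))
        ∂spikeSlabPrior u ρ₀ ≤ ENNReal.ofReal N)
    (hN2 : ∫⁻ θ in {θ | R < l2 (mask θ.1 θ.2)}, ENNReal.ofReal (Real.exp (logRatio σ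
      (fun i => x i - g (y i)) fun i => gW (mask θ.1 θ.2) (y i) - g (y i)))
        ∂spikeSlabPrior u ρ₀ ≤ ENNReal.ofReal N)
    (hD0 : 0 < D)
    (hD : ENNReal.ofReal D ≤ ∫⁻ θ, ENNReal.ofReal (Real.exp (logRatio σ
      (fun i => x i - g (y i)) fun i => gW (mask θ.1 θ.2) (y i) - g (y i)))
        ∂spikeSlabPrior u ρ₀) :
    spikeSlabPosterior gW u ρ₀ σ x y
      {θ | ε < empNorm y (fun z => gW (mask θ.1 θ.2) z - g z)} ≤ ENNReal.ofReal (3 * N / D) := by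
  refine spikeSlabPosterior_le gW g u ρ₀ σ x y _ hD0 hD ?_
  set G : (ι → Bool) × (ι → ℝ) → ℝ≥0∞ := fun θ => ENNReal.ofReal (Real.exp (logRatio σ
    (fun i => x i - g (y i)) fun i => gW (mask θ.1 θ.2) (y i) - g (y i))) with hGdef
  have hG : Measurable G := (Real.measurable_exp.comp hm).ennreal_ofReal
  have hn1 : (1 : ℝ) ≤ n := by exact_mod_cast hn
  have hN : 0 ≤ N := (Real.exp_nonneg _).trans hN0
  let A₀ : Set ((ι → Bool) × (ι → ℝ)) := {θ | G θ ≤ ENNReal.ofReal N}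
  let A₁ : Set ((ι → Bool) × (ι → ℝ)) := {θ | κ < activeCount θ.1}
  let A₂ : Set ((ι → Bool) × (ι → ℝ)) := {θ | R < l2 (mask θ.1 θ.2)}
  have hcover : {θ : (ι → Bool) × (ι → ℝ) | ε < empNorm y
      (fun z => gW (mask θ.1 θ.2) z - g z)} ⊆ A₀ ∪ A₁ ∪ A₂ := by
    intro θ hθ
    by_cases hθ1 : θ ∈ A₁
    · exact Or.inl (Or.inr hθ1)
    by_cases hθ2 : θ ∈ A₂
    · exact Or.inr hθ2
    refine Or.inl (Or.inl ?_)
    simp only [A₁, A₂, Set.mem_ofPred_eq, not_lt] at hθ1 hθ2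
    have hemp : n * ε ^ 2 ≤ ∑ i, ‖gW (mask θ.1 θ.2) (y i) - g (y i)‖ ^ 2 := by
      simp only [Set.mem_ofPred_eq, empNorm] at hθ
      rw [Real.lt_sqrt hε.le, one_div, inv_mul_eq_div, lt_div_iff₀ (by linarith), mul_comm] at hθ
      exact hθ.le
    have hinner := hsieve (mask θ.1 θ.2) ((Nat.cast_le.2 (l0_mask_le _ _)).trans hθ1) hθ2 hemp
    exact ENNReal.ofReal_le_ofReal
      ((Real.exp_le_exp.2 (logRatio_le_neg hσ hemp hinner)).trans hN0)
  have hA0 : MeasurableSet A₀ := measurableSet_le hG measurable_const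
  have hI0 : ∫⁻ θ in A₀, G θ ∂spikeSlabPrior u ρ₀ ≤ ENNReal.ofReal N := by
    calc _ ≤ ∫⁻ _ in A₀, ENNReal.ofReal N ∂spikeSlabPrior u ρ₀ :=
          setLIntegral_mono' hA0 fun θ hθ => hθ
      _ ≤ ENNReal.ofReal N * 1 := by
          rw [setLIntegral_const]
          gcongr
          exact prob_le_one
      _ = _ := mul_one _
  calc _ ≤ ∫⁻ θ in A₀ ∪ A₁ ∪ A₂, G θ ∂spikeSlabPrior u ρ₀ := lintegral_mono_set hcover
    _ ≤ ∫⁻ θ in A₀, G θ ∂spikeSlabPrior u ρ₀ + ∫⁻ θ in A₁, G θ ∂spikeSlabPrior u ρ₀ +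
        ∫⁻ θ in A₂, G θ ∂spikeSlabPrior u ρ₀ :=
        (lintegral_union_le _ _ _).trans (add_le_add_left (lintegral_union_le _ _ _) _)
    _ ≤ ENNReal.ofReal N + ENNReal.ofReal N + ENNReal.ofReal N :=
        add_le_add (add_le_add hI0 hN1) hN2
    _ = _ := by
        rw [← ENNReal.ofReal_add hN hN, ← ENNReal.ofReal_add (by positivity) hN]
        congr 1
        ring

section Contraction

variable {Ω : Type*} [MeasurableSpace Ω] {P : Measure Ω} [IsProbabilityMeasure P] {n dx dy : ℕ}
  {Yset : Set (EuclideanSpace ℝ (Fin dy))}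
  {g : EuclideanSpace ℝ (Fin dy) → EuclideanSpace ℝ (Fin dx)}
  {X : Fin n → Ω → EuclideanSpace ℝ (Fin dx)} {Y : Fin n → Ω → EuclideanSpace ℝ (Fin dy)}
  {σs : Fin n → ℝ} {c σ : ℝ} {ι : Type*} [Fintype ι] [DecidableEq ι] [Nonempty ι]
  {gW : (ι → ℝ) → EuclideanSpace ℝ (Fin dy) → EuclideanSpace ℝ (Fin dx)} {L : ℝ → ℝ}

/-- The evidence bound at the sparse approximation of the truth. -/
theorem IsSample.measure_evidence_lt_exp_le (hS : IsSample P Yset g X Y σs) (hg : Measurable g)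
    (hc : ∀ i, σs i ≤ c) (hc0 : 0 < c) (hcσ : c ≤ σ) (hY : MeasurableSet Yset)
    (hgW : ∀ W, Measurable (gW W)) (hL : LocallyLipschitzClass Yset gW L) {u sst ϖ s : ℝ}
    (ρ₀ : ℝ) (hu : 1 ≤ u) (hsst : 1 ≤ sst) (hϖ : 0 ≤ ϖ)
    (happ : SparselyApproximable Yset gW g sst ϖ) (hn : 1 ≤ n)
    (hl : 0 < Real.log (Fintype.card ι)) (hσl : 70 ≤ σ * √(Real.log (Fintype.card ι)))
    (hσn : σ ^ 2 * Real.log (Fintype.card ι) ≤ n)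
    (hs : s = effSparsity n (Fintype.card ι) u σ L sst ϖ) :
    P {ω | ∫⁻ θ, ENNReal.ofReal (Real.exp (logRatio σ (fun i => X i ω - g (Y i ω))
      fun i => residual Yset gW g (mask θ.1 θ.2) (Y i ω))) ∂spikeSlabPrior u ρ₀ <
      ENNReal.ofReal (Real.exp (-(((u + 1) * s + s / 12 + 1 / 3) *
        Real.log (Fintype.card ι) + Real.log 6)))} ≤
    ENNReal.ofReal (2 / Fintype.card ι) := by
  classical
  set l := Real.log (Fintype.card ι) with hldef
  have hq : (0 : ℝ) < Fintype.card ι := by exact_mod_cast Fintype.card_pos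
  have hn1 : (1 : ℝ) ≤ n := by exact_mod_cast hn
  have hsn : 1 ≤ √(n : ℝ) := Real.one_le_sqrt.2 hn1
  have hσ : 0 < σ := hc0.trans_le hcσ
  have hη : 0 < 2 * √sst := by
    have := Real.sqrt_pos.2 (zero_lt_one.trans_le hsst); positivity
  obtain ⟨w, hw0, hw1, hw⟩ := happ
  set Lst := L (2 * √sst) with hLst
  have hLst1 : 1 ≤ Lst := (hL _ hη).1
  let Λ : ι → Bool := fun j => decide (w j ≠ 0)
  have hΛ : ∀ j, Λ j = true ↔ w j ≠ 0 := fun j => by simp [Λ]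
  have hcount : (activeCount Λ : ℝ) ≤ sst := by
    refine le_trans ?_ hw0
    rw [activeCount, l0, ← Set.ncard_coe_finset]
    refine Nat.cast_le.2 (Set.ncard_le_ncard (fun j hj => ?_) (Set.toFinite _))
    simpa [Λ] using hj
  set a := σ * √l / (7 * (Lst * √n)) with ha
  have hsl : 0 < √l := Real.sqrt_pos.2 hl
  have ha0 : 0 < a := by positivity
  have ha1 : a ≤ 1 := by
    rw [ha, div_le_one (by positivity)]
    have h1 : σ * √l ≤ √n := by
      apply Real.le_sqrt_of_sq_le
      rw [mul_pow, Real.sq_sqrt hl.le]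
      exact hσn
    nlinarith
  have hsqrt : √(activeCount Λ : ℝ) ≤ √sst := Real.sqrt_le_sqrt hcount
  have hF : ∀ W : ι → ℝ, (∀ j, Λ j = true → |W j - w j| ≤ a) → ∀ y,
      ‖residual Yset gW g (mask Λ W) y‖ ≤ ϖ + Lst * (√sst * a) := by
    intro W hW y
    by_cases hy : y ∈ Yset
    · have hmask : l2 (mask Λ W) ≤ 2 * √sst := by
        refine (l2_le_sqrt_activeCount_mul (Λ := Λ) (b := 2) (by norm_num) fun j => ?_).trans
          (by linarith)
        by_cases hj : Λ j = true
        · simp only [mask, hj, if_true]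
          have h1 := abs_sub_abs_le_abs_sub (W j) (w j)
          linarith [hW j hj, hw1 j]
        · simp [mask, hj]
      have hwl2 : l2 w ≤ 2 * √sst := by
        refine (l2_le_sqrt_activeCount_mul (Λ := Λ) (b := 2) (by norm_num) fun j => ?_).trans
          (by linarith)
        by_cases hj : Λ j = true
        · simp only [hj, if_true]
          linarith [hw1 j]
        · have : w j = 0 := by rw [hΛ] at hj; tauto
          simp [hj, this]
      have hdiff : l2 (mask Λ W - w) ≤ √sst * a := by
        refine (l2_le_sqrt_activeCount_mul (Λ := Λ) ha0.le fun j => ?_).trans (by gcongr)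
        by_cases hj : Λ j = true
        · simpa [mask, hj] using hW j hj
        · have : w j = 0 := by rw [hΛ] at hj; tauto
          simp [mask, hj, this]
      have h1 := (hL _ hη).2 (mask Λ W) w (max_le hmask hwl2) y hy
      rw [residual, Set.indicator_of_mem hy]
      calc ‖gW (mask Λ W) y - g y‖ ≤ ‖gW w y - g y‖ + ‖gW (mask Λ W) y - gW w y‖ := by
            rw [add_comm]; exact norm_sub_le_norm_sub_add_norm_sub _ _ _
        _ ≤ ϖ + Lst * (√sst * a) := by
            gcongr
            · exact hw y hy
            · exact h1.trans (by gcongr)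
    · rw [residual, Set.indicator_of_notMem hy, norm_zero]
      positivity
  have h := hS.measure_evidence_lt_le hg hc hc0 hcσ (hL.measurable_uncurry_residual hY hgW hg) u ρ₀
    Λ hw1 ha0 ha1 hF l
  have hexp : 2 * Real.exp (-l) = 2 / Fintype.card ι := by
    rw [Real.exp_neg, hldef, Real.exp_log hq, div_eq_mul_inv]
  rw [hexp] at h
  refine (measure_mono ?_).trans h
  intro ω hω
  simp only [Set.mem_ofPred_eq] at hω ⊢
  refine hω.trans_le (ENNReal.ofReal_le_ofReal ?_)
  refine (exp_le_evidence_bound hσ hl hn hLst1 hcount hu hsst hσl ha hs).trans ?_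
  have h3 := structureWeight_div_three_le (by linarith : 0 ≤ u) Λ
  rw [structureWeight_eq_exp] at h3
  gcongr

/-- Contraction at the radius `ε = M r` for the largest admissible `M`, on the complement of
exceptional events of total probability at most `9 / q`. -/
theorem IsSample.measure_not_spikeSlabPosterior_le (hS : IsSample P Yset g X Y σs)
    (hg : Measurable g) (hc : ∀ i, σs i ≤ c) (hc0 : 0 < c) (hcσ : c ≤ σ) (hY : MeasurableSet Yset)
    (hgW : ∀ W, Measurable (gW W)) (hL : LocallyLipschitzClass Yset gW L) {u sst ϖ s ε : ℝ}
    (ρ₀ : ℝ) (hu : 1 ≤ u) (hsst : 1 ≤ sst) (hϖ : 0 ≤ ϖ)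
    (happ : SparselyApproximable Yset gW g sst ϖ) (hn : 1 ≤ n) (hd : dx ≤ Fintype.card ι)
    (hl : 20 ≤ Real.log (Fintype.card ι)) (hσl : 70 ≤ σ * √(Real.log (Fintype.card ι)))
    (hσn : σ ^ 2 * Real.log (Fintype.card ι) ≤ n)
    (hs : s = effSparsity n (Fintype.card ι) u σ L sst ϖ) (hss : sst ≤ s) (hε : 0 < ε)
    (hnε : n * ε ^ 2 = 12800 * (u * σ ^ 2 * s * (Real.log (Fintype.card ι)
      + Real.log (lipAt (Fintype.card ι) u L s)) + c ^ 2 * s * Real.log n)) :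
    P {ω | ¬ spikeSlabPosterior gW u ρ₀ σ (fun i => X i ω) (fun i => Y i ω)
        {θ | ε < empNorm (fun i => Y i ω) (fun y => gW (mask θ.1 θ.2) y - g y)} ≤
          ENNReal.ofReal (12 / Fintype.card ι)} ≤ ENNReal.ofReal (9 / Fintype.card ι) := by
  set q := Fintype.card ι with hqdef
  set l := Real.log q with hldef
  have hqpos : 0 < q := Fintype.card_pos
  have hq : (0 : ℝ) < q := by exact_mod_cast hqpos
  have hexpl : Real.exp l = q := Real.exp_log hq
  have hq3 : 3 ≤ q := by
    have h1 : (3 : ℝ) ≤ q := by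
      rw [← hexpl]; linarith [Real.add_one_le_exp l]
    exact_mod_cast h1
  have hn1 : (1 : ℝ) ≤ n := by exact_mod_cast hn
  have hσ : 0 < σ := hc0.trans_le hcσ
  have hs1 : 1 ≤ s := hsst.trans hss
  have hl0 : 0 < l := by linarith
  set R := √s * √(2 * (1 + u) * (1 + s) * l) with hR
  have hR0 : 0 < R := by positivity
  have hR2 : R ^ 2 = 2 * (1 + u) * (1 + s) * l * s := by
    rw [hR, mul_pow, Real.sq_sqrt (by linarith), Real.sq_sqrt (by positivity), mul_comm]
  have hLs : lipAt q u L s = L R := rfl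
  have hLs1 : 1 ≤ L R := (hL R hR0).1
  rw [hLs] at hnε
  obtain ⟨f, hf⟩ : ∃ f, f = residual Yset gW g := ⟨_, rfl⟩
  have hfm : Measurable (Function.uncurry f) := hf ▸ hL.measurable_uncurry_residual hY hgW hg
  have hfV : ∀ V, Measurable (f V) := fun V => hf ▸ measurable_residual hY hgW hg V
  have hσl1 : 1 ≤ σ ^ 2 * l := by
    have h1 : (σ * √l) ^ 2 = σ ^ 2 * l := by rw [mul_pow, Real.sq_sqrt hl0.le]
    rw [← h1]
    exact one_le_pow₀ (by linarith)
  let G : (ι → Bool) × (ι → ℝ) → Ω → ℝ≥0∞ := fun θ ω =>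
    ENNReal.ofReal (Real.exp (logRatio σ (fun i => X i ω - g (Y i ω))
      fun i => f (mask θ.1 θ.2) (Y i ω)))
  have hfmask : Measurable (Function.uncurry fun θ : (ι → Bool) × (ι → ℝ) => f (mask θ.1 θ.2)) :=
    hfm.comp ((measurable_mask.comp measurable_fst).prodMk measurable_snd)
  have hG : Measurable (Function.uncurry G) :=
    (Real.measurable_exp.comp (hS.measurable_logRatio hg hfmask σ)).ennreal_ofReal
  have hG1 : ∀ θ, ∫⁻ ω, G θ ω ∂P ≤ 1 := fun θ =>
    hS.lintegral_exp_logRatio_le_one hg hc hc0 hcσ (hfV _)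
  have hu0 : 0 ≤ u := by linarith
  -- parameters outside of the sieve, whose prior mass controls their contribution
  let A₁ : Set ((ι → Bool) × (ι → ℝ)) := {θ | 6 * s < activeCount θ.1}
  let A₂ : Set ((ι → Bool) × (ι → ℝ)) := {θ | R < l2 (mask θ.1 θ.2)}
  set y := ((u + 1) * s + s / 12 + 1 / 3) * l + Real.log 6 with hy
  have hE1 := hS.measure_exists_sieve_le (κ := 6 * s) hg hc hc0 hd hn hfV hR0.le
    (zero_lt_one.trans_le hLs1) hε
    (fun V V' hV hV' y => hf ▸ hL.norm_residual_sub_le (g := g) hR0 hV hV' y)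
  have hE2 : P {ω | ENNReal.ofReal (q * Real.exp (1 - u * (6 * s) * l)) <
      ∫⁻ θ in A₁, G θ ω ∂spikeSlabPrior u ρ₀} ≤ ENNReal.ofReal (1 / q) :=
    measure_lt_setLIntegral_le hG hG1 (spikeSlabPrior_activeCount_lt_le hu0 ρ₀ (6 * s))
      (Real.exp_pos _) hq
  have hE3 : P {ω | ENNReal.ofReal (q * Real.exp (4 - u * l - 15 / 32 * R ^ 2)) <
      ∫⁻ θ in A₂, G θ ω ∂spikeSlabPrior u ρ₀} ≤ ENNReal.ofReal (1 / q) :=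
    measure_lt_setLIntegral_le hG hG1 (spikeSlabPrior_l2_mask_lt_le hu0 ρ₀ hR0.le)
      (Real.exp_pos _) hq
  have hE4 := hS.measure_evidence_lt_exp_le hg hc hc0 hcσ hY hgW hL ρ₀ hu hsst hϖ happ hn hl0 hσl
    hσn hs
  rw [← hf] at hE4
  have hE5 : P {ω | ¬ ∀ i, Y i ω ∈ Yset} = 0 := by
    rw [← ae_iff]
    exact ae_all_iff.2 hS.mem_Yset
  replace hE1 := hE1.trans (add_le_add_right (ENNReal.ofReal_le_ofReal
    (card_net_mul_exp_le hu hc0 hcσ hs1 hq3 hn hLs1 (by linarith) hσl1 hε hnε)) _)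
  set B₁ := {ω | ∃ V, (l0 V : ℝ) ≤ 6 * s ∧ l2 V ≤ R ∧ n * ε ^ 2 ≤ ∑ i, ‖f V (Y i ω)‖ ^ 2 ∧
        3 / 8 * ∑ i, ‖f V (Y i ω)‖ ^ 2 <
          ∑ i, inner ℝ (f V (Y i ω)) (X i ω - g (Y i ω))} with hB1
  set B₂ := {ω | ENNReal.ofReal (q * Real.exp (1 - u * (6 * s) * l)) <
      ∫⁻ θ in A₁, G θ ω ∂spikeSlabPrior u ρ₀}
  set B₃ := {ω | ENNReal.ofReal (q * Real.exp (4 - u * l - 15 / 32 * R ^ 2)) <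
      ∫⁻ θ in A₂, G θ ω ∂spikeSlabPrior u ρ₀}
  set B₄ := {ω | ∫⁻ θ, G θ ω ∂spikeSlabPrior u ρ₀ < ENNReal.ofReal (Real.exp (-y))} with hB4
  set B₅ := {ω | ¬ ∀ i, Y i ω ∈ Yset}
  have hP : P (B₁ ∪ B₂ ∪ B₃ ∪ B₄ ∪ B₅) ≤ ENNReal.ofReal (9 / q) := by
    calc P (B₁ ∪ B₂ ∪ B₃ ∪ B₄ ∪ B₅) ≤ P B₁ + P B₂ + P B₃ + P B₄ + P B₅ := by
          refine (measure_union_le _ _).trans (add_le_add_left ?_ _)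
          refine (measure_union_le _ _).trans (add_le_add_left ?_ _)
          refine (measure_union_le _ _).trans (add_le_add_left ?_ _)
          exact measure_union_le _ _
      _ ≤ (ENNReal.ofReal (4 / q) + ENNReal.ofReal (1 / q)) + ENNReal.ofReal (1 / q)
          + ENNReal.ofReal (1 / q) + ENNReal.ofReal (2 / q) + 0 := by
          gcongr
          exact hE5.le
      _ = ENNReal.ofReal (9 / q) := by
          rw [add_zero, ← ENNReal.ofReal_add (by positivity) (by positivity),
            ← ENNReal.ofReal_add (by positivity) (by positivity),
            ← ENNReal.ofReal_add (by positivity) (by positivity),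
            ← ENNReal.ofReal_add (by positivity) (by positivity)]
          congr 1
          ring
  refine (measure_mono ?_).trans hP
  intro ω hω
  by_contra hgood
  simp only [Set.mem_union, not_or] at hgood
  obtain ⟨⟨⟨⟨h1, h2⟩, h3⟩, h4⟩, h5⟩ := hgood
  simp only [B₁, B₂, B₃, B₄, B₅, Set.mem_ofPred_eq, not_lt, not_not] at h1 h2 h3 h4 h5
  rw [Set.mem_ofPred_eq] at hω
  refine hω ?_
  -- on the good event the residuals are the true approximation errors
  have hfeq : ∀ V i, f V (Y i ω) = gW V (Y i ω) - g (Y i ω) := fun V i => by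
    rw [hf, residual, Set.indicator_of_mem (h5 i)]
  obtain ⟨hy0, hy1, hy2⟩ := numerator_exponents_le hu hs1 hl
  rw [← hy] at hy0 hy1 hy2
  have hb1 : q * Real.exp (1 - u * (6 * s) * l) ≤ Real.exp (-y - l) := by
    rw [← hexpl, ← Real.exp_add]
    exact Real.exp_le_exp.2 hy1
  have hb2 : q * Real.exp (4 - u * l - 15 / 32 * R ^ 2) ≤ Real.exp (-y - l) := by
    rw [← hexpl, ← Real.exp_add, hR2]
    exact Real.exp_le_exp.2 hy2
  have hb0 : Real.exp (-(n * ε ^ 2 / (8 * σ ^ 2))) ≤ Real.exp (-y - l) := by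
    have h6 : 1600 * (u * s * l) ≤ n * ε ^ 2 / (8 * σ ^ 2) := by
      rw [le_div_iff₀ (by positivity), hnε]
      have h7 : 0 ≤ u * σ ^ 2 * s * Real.log (L R) :=
        mul_nonneg (by positivity) (Real.log_nonneg hLs1)
      have h8 : 0 ≤ c ^ 2 * s * Real.log n := mul_nonneg (by positivity) (Real.log_nonneg hn1)
      linarith
    exact Real.exp_le_exp.2 (by linarith)
  have hm : Measurable fun θ : (ι → Bool) × (ι → ℝ) => logRatio σ (fun i => X i ω - g (Y i ω))
      fun i => f (mask θ.1 θ.2) (Y i ω) :=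
    (hS.measurable_logRatio hg hfmask σ).of_uncurry_right
  have hsieve : ∀ V, (l0 V : ℝ) ≤ 6 * s → l2 V ≤ R → n * ε ^ 2 ≤ ∑ i, ‖f V (Y i ω)‖ ^ 2 →
      ∑ i, inner ℝ (f V (Y i ω)) (X i ω - g (Y i ω)) ≤ 3 / 8 * ∑ i, ‖f V (Y i ω)‖ ^ 2 := by
    intro V hV0 hV2 hV
    by_contra hlt
    exact h1 ⟨V, hV0, hV2, hV, not_le.1 hlt⟩
  simp only [G, A₁, A₂, hfeq] at hm hsieve h2 h3 h4
  have key := spikeSlabPosterior_empNorm_le (u := u) (ρ₀ := ρ₀) hn hσ hε hm hsieve hb0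
    (h2.trans (ENNReal.ofReal_le_ofReal hb1)) (h3.trans (ENNReal.ofReal_le_ofReal hb2))
    (Real.exp_pos (-y)) h4
  refine key.trans (ENNReal.ofReal_le_ofReal ?_)
  rw [sub_eq_add_neg, Real.exp_add, Real.exp_neg l, hexpl]
  have := Real.exp_pos (-y)
  field_simp
  norm_num

end Contraction

end SparseBNN

theorem theorem2 :
    -- `C`, `c₁` are absolute constants
    ∃ C c₁ : ℝ, 0 < C ∧ 0 < c₁ ∧
    ∀ u σ : ℝ, 1 ≤ u → 0 < σ →
    -- `q` large enough: `q ≥ q₀(u, σ)` and `q ≥ dx`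
    ∃ q₀ : ℕ, ∀ (D : ℕ) (p : Fin (D + 1) → ℕ) (n dx dy : ℕ),
      q₀ ≤ SparseBNN.numParams p → dx ≤ SparseBNN.numParams p →
      σ ^ 2 * Real.log (SparseBNN.numParams p) ≤ (n : ℝ) →
    ∀ (Ω : Type*) [MeasurableSpace Ω] (P : Measure Ω) [IsProbabilityMeasure P]
      (Yset : Set (EuclideanSpace ℝ (Fin dy)))
      (g : EuclideanSpace ℝ (Fin dy) → EuclideanSpace ℝ (Fin dx))
      (X : Fin n → Ω → EuclideanSpace ℝ (Fin dx)) (Y : Fin n → Ω → EuclideanSpace ℝ (Fin dy))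
      (σs : Fin n → ℝ)
      (gW : (SparseBNN.WeightIndex p → ℝ) →
        EuclideanSpace ℝ (Fin dy) → EuclideanSpace ℝ (Fin dx))
      (L : ℝ → ℝ) (ρ₀ σbar sstar ϖ : ℝ),
      MeasurableSet Yset → Measurable g → (∀ W, Measurable (gW W)) →
      0 < ρ₀ →
      SparseBNN.IsSample P Yset g X Y σs →
      σbar = (⨆ i, σs i) → 0 < σbar → σbar ≤ σ →
      SparseBNN.LocallyLipschitzClass Yset gW L →
      1 ≤ sstar → 0 ≤ ϖ →
      SparseBNN.SparselyApproximable Yset gW g sstar ϖ →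
    ∀ s r : ℝ, s = SparseBNN.effSparsity n (SparseBNN.numParams p) u σ L sstar ϖ →
      r = SparseBNN.rate n (SparseBNN.numParams p) u σbar L s →
    ∃ M : ℝ, 0 ≤ M ∧ u * max ((σ / σbar) ^ 2) 1 ≤ M ^ 2 ∧
      M ^ 2 ≤ C * (u * max ((σ / σbar) ^ 2) 1 + Real.log n /
        Real.log (SparseBNN.numParams p * SparseBNN.lipAt (SparseBNN.numParams p) u L s)) ∧
      P {ω | ¬ SparseBNN.spikeSlabPosterior gW u ρ₀ σ (fun i => X i ω) (fun i => Y i ω)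
            {θ | M * r < SparseBNN.empNorm (fun i => Y i ω)
              (fun y => gW (SparseBNN.mask θ.1 θ.2) y - g y)}
          ≤ ENNReal.ofReal (12 / (SparseBNN.numParams p : ℝ))}
        ≤ ENNReal.ofReal (Real.exp (-c₁ * n) + c₁ / (SparseBNN.numParams p : ℝ)) := by
  -- `q₀` is chosen such that `20 ≤ log q` and `70 ≤ σ √(log q)`
  refine ⟨12800, 9, by norm_num, by norm_num, fun u σ hu hσ =>
    ⟨⌈Real.exp (20 + (70 / σ) ^ 2)⌉₊, ?_⟩⟩
  intro D p n dx dy hq₀ hd hσn Ω _ P _ Yset g X Y σs gW L ρ₀ σbar sst ϖ hY hg hgW _ hS hσbar hσbar0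
    hσbarσ hL hsst hϖ happ s r hs hr
  rw [← SparseBNN.card_weightIndex] at hq₀ hd hσn hs hr ⊢
  set q := Fintype.card (SparseBNN.WeightIndex p) with hqdef
  set l := Real.log q with hldef
  have hqexp : Real.exp (20 + (70 / σ) ^ 2) ≤ q := Nat.ceil_le.1 hq₀
  have hq : (0 : ℝ) < q := (Real.exp_pos _).trans_le hqexp
  have hne : Nonempty (SparseBNN.WeightIndex p) :=
    Fintype.card_pos_iff.1 (by exact_mod_cast hq)
  have hl' : 20 + (70 / σ) ^ 2 ≤ l := (Real.le_log_iff_exp_le hq).2 hqexp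
  have hl : 20 ≤ l := by linarith [sq_nonneg (70 / σ)]
  have hσl : 70 ≤ σ * √l := by
    have h1 : 70 / σ ≤ √l := Real.le_sqrt_of_sq_le (by linarith)
    rwa [div_le_iff₀' hσ] at h1
  have hn : 1 ≤ n := by
    have h1 : (0 : ℝ) < n := lt_of_lt_of_le (by positivity) hσn
    exact Nat.one_le_iff_ne_zero.2 (by exact_mod_cast h1.ne')
  have hn1 : (1 : ℝ) ≤ n := by exact_mod_cast hn
  have hσs : ∀ i, σs i ≤ σbar := fun i => hσbar ▸ le_ciSup (Set.finite_range σs).bddAbove i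
  have hss : sst ≤ s := by
    have hη : 0 < 2 * √sst := by
      have := Real.sqrt_pos.2 (zero_lt_one.trans_le hsst)
      positivity
    have h1 : 1 ≤ L (2 * √sst) * √n :=
      one_le_mul_of_one_le_of_one_le (hL _ hη).1 (Real.one_le_sqrt.2 hn1)
    have h2 := Real.log_nonneg h1
    rw [hs, SparseBNN.effSparsity, ← hldef, add_mul, one_mul, add_assoc]
    exact le_add_of_nonneg_right (by positivity)
  have hs1 : 1 ≤ s := hsst.trans hss
  have hLs : 1 ≤ SparseBNN.lipAt q u L s := (hL _ (by positivity)).1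
  set lam := Real.log (SparseBNN.lipAt q u L s) with hlam
  have hlam0 : 0 ≤ lam := Real.log_nonneg hLs
  have hln : 0 ≤ Real.log n := Real.log_nonneg hn1
  have hlogmul : Real.log (q * SparseBNN.lipAt q u L s) = l + lam :=
    Real.log_mul hq.ne' (by linarith)
  have hmax : max ((σ / σbar) ^ 2) 1 = (σ / σbar) ^ 2 :=
    max_eq_left (one_le_pow₀ ((one_le_div hσbar0).2 hσbarσ))
  rw [hlogmul, hmax]
  -- the largest admissible `M`, for which the `log n` term pays for the mesh of the net
  set K := 12800 * (u * (σ / σbar) ^ 2 + Real.log n / (l + lam)) with hK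
  have hK0 : 0 < K := by
    have h1 : 0 ≤ Real.log n / (l + lam) := by positivity
    positivity
  have hr0 : 0 < r := by
    rw [hr, SparseBNN.rate]
    have : 0 < s * l + s * lam := by positivity
    positivity
  have hnr : n * r ^ 2 = σbar ^ 2 * (s * (l + lam)) := by
    rw [hr, SparseBNN.rate, ← hlam, ← hldef, mul_pow, Real.sq_sqrt (by positivity)]
    field_simp
  refine ⟨√K, Real.sqrt_nonneg _, ?_, (Real.sq_sqrt hK0.le).le, ?_⟩
  · rw [Real.sq_sqrt hK0.le, hK]
    have h1 : 0 ≤ Real.log n / (l + lam) := by positivity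
    have h2 : 0 ≤ u * (σ / σbar) ^ 2 := by positivity
    linarith
  have hε : n * (√K * r) ^ 2 = 12800 * (u * σ ^ 2 * s * (l + lam) + σbar ^ 2 * s * Real.log n) := by
    have h1 : l + lam ≠ 0 := by positivity
    rw [mul_pow, Real.sq_sqrt hK0.le, mul_left_comm, hnr, hK]
    field_simp
  refine (hS.measure_not_spikeSlabPosterior_le hg hσs hσbar0 hσbarσ hY hgW hL ρ₀ hu hsst hϖ happ hn
    hd hl hσl hσn hs hss (by positivity) hε).trans (ENNReal.ofReal_le_ofReal ?_)
  exact le_add_of_nonneg_left (Real.exp_nonneg _)
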